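/- Let $k$ be a field. For a Hopf $k$-algebra $A$ with antipode $S$, let $\mathrm{Co}_f(A)$ be the monoidal category of finite-dimensional right $A$-comodules, let $\mathrm{Vect}_f(k)$ be the monoidal category of finite-dimensional $k$-vector spaces, and let $F:\mathrm{Co}_f(A)\to \mathrm{Vect}_f(k)$ be the (monoidal) forgetful functor. A left dual of an object $X$ of a monoidal category is an object ${}^\vee X$ with morphisms ${}^\vee X\otimes X\to I$ and $I\to X\otimes{}^\vee X$ satisfying the two triangle identities; a right dual is an object $X^\vee$ with morphisms $X\otimes X^\vee\to I$ and $I\to X^\vee\otimes X$ satisfying the two triangle identities. A monoidal category is autonomous if every object has a left and a right dual. An autonomous structure is a choice of a left and a right dual for every object, such that $I$ with the unit constraints is the chosen left and right dual of $I$; it determines the contravariant monoidal left and right duality functors $\mathbf D_l: X\mapsto {}^\vee X$ and $\mathbf D_r: X\mapsto X^\vee$. A sovereign structure on a monoidal category consists of an autonomous structure and an isomorphism of monoidal functors $\varphi:\mathbf D_r\to\mathbf D_l$, with components $\varphi_X:X^\vee\to{}^\vee X$. A monoidal functor $G$ between monoidal categories with sovereign structures $\varphi$ and $\psi$ is sovereign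 (with respect to $\varphi$ and $\psi$) if $G(\varphi_X)\circ r_X=l_X\circ\psi_{G(X)}$ for every $X$, where $l_X:{}^\vee G(X)\to G({}^\vee X)$ and $r_X: G(X)^\vee\to G(X^\vee)$ are the canonical isomorphisms between left, respectively right, duals of $G(X)$. If $S$ is bijective, a sovereign character on $A$ is an algebra morphism $\Phi:A\to k$ such that $S^{-1}=\Phi*S*\Phi^{-1}$, where $*$ is the convolution product and $\Phi^{-1}=\Phi\circ S$ is the convolution inverse of $\Phi$. (i) Let $A$ be a Hopf algebra with bijective antipode. Then there is a sovereign character on $A$ if and only if there is a sovereign structure on $\mathrm{Co}_f(A)$. (ii) Let $A$ be a Hopf algebra. The following are equivalent: (a) $S^2=\mathrm{id}_A$; (b) $\mathrm{Co}_f(A)$ is autonomous and admits a sovereign structure for which $F$ is sovereign with respect to every sovereign structure on $\mathrm{Vect}_f(k)$; (c) $\mathrm{Co}_f(A)$ is autonomous and admits a sovereign structure for which $F$ is sovereign with respect to some sovereign structure on $\mathrm{Vect}_f(k)$. -/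

import Mathlib

open CategoryTheory MonoidalCategory Opposite
open scoped TensorProduct

universe w v u

noncomputable section

/-! ### Autonomous and sovereign monoidal categories

Mathlib's `ExactPairing X Y` consists of `I ⟶ X ⊗ Y` and `Y ⊗ X ⟶ I` with the two triangle
identities. So a *left* dual `ᵛX` (with `ᵛX ⊗ X ⟶ I` and `I ⟶ X ⊗ ᵛX`) is a `HasRightDual X` in
Mathlib's terminology, and a *right* dual `Xᵛ` (with `X ⊗ Xᵛ ⟶ I` and `I ⟶ Xᵛ ⊗ X`) is a
`HasLeftDual X`. Below, "left" and "right" are used in the first sense. -/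

section Categorical

variable (C : Type u) [Category.{v} C] [MonoidalCategory C]

/-- A monoidal category is autonomous if every object has a left dual and a right dual. -/
def IsAutonomous : Prop :=
  ∀ X : C, Nonempty (HasRightDual X) ∧ Nonempty (HasLeftDual X)

/-- An autonomous structure: the choice of a left dual and of a right dual of every object, the
unit object being its own left and right dual through the unit constraint. -/
structure AutonomousStructure where
  /-- the chosen left dual `ᵛX` -/
  left : ∀ X : C, HasRightDual X
  /-- the chosen right dual `Xᵛ` -/
  right : ∀ X : C, HasLeftDual X
  left_unit : left (𝟙_ C) = hasRightDualUnit
  right_unit : right (𝟙_ C) = hasLeftDualUnit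

namespace AutonomousStructure

variable {C} (𝒜 : AutonomousStructure C)

/-- The object `ᵛX`. -/
def leftObj (X : C) : C := (𝒜.left X).rightDual

/-- The object `Xᵛ`. -/
def rightObj (X : C) : C := (𝒜.right X).leftDual

/-- The pairing `ᵛX ⊗ X ⟶ I`, `I ⟶ X ⊗ ᵛX`. -/
@[reducible]
def leftPairing (X : C) : ExactPairing X (𝒜.leftObj X) := (𝒜.left X).exact

/-- The pairing `X ⊗ Xᵛ ⟶ I`, `I ⟶ Xᵛ ⊗ X`. -/
@[reducible]
def rightPairing (X : C) : ExactPairing (𝒜.rightObj X) X := (𝒜.right X).exact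

/-- The left duality functor, `X ↦ ᵛX` on objects and the left transpose on morphisms. -/
def leftDuality : Cᵒᵖ ⥤ C where
  obj X := 𝒜.leftObj X.unop
  map {X Y} f := @rightAdjointMate C _ _ Y.unop X.unop (𝒜.left _) (𝒜.left _) f.unop
  map_id X := @rightAdjointMate_id C _ _ X.unop (𝒜.left _)
  map_comp {X Y Z} f g :=
    @comp_rightAdjointMate C _ _ Z.unop Y.unop X.unop (𝒜.left _) (𝒜.left _) (𝒜.left _)
      g.unop f.unop

/-- The right duality functor, `X ↦ Xᵛ` on objects and the right transpose on morphisms. -/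
def rightDuality : Cᵒᵖ ⥤ C where
  obj X := 𝒜.rightObj X.unop
  map {X Y} f := @leftAdjointMate C _ _ Y.unop X.unop (𝒜.right _) (𝒜.right _) f.unop
  map_id X := @leftAdjointMate_id C _ _ X.unop (𝒜.right _)
  map_comp {X Y Z} f g :=
    @comp_leftAdjointMate C _ _ Z.unop Y.unop X.unop (𝒜.right _) (𝒜.right _) (𝒜.right _)
      g.unop f.unop

/-- The monoidal constraint `ᵛ(X ⊗ Y) ≅ ᵛY ⊗ ᵛX` of the left duality functor: the canonical
isomorphism between two left duals of `X ⊗ Y`. -/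
def leftTensorIso (X Y : C) : 𝒜.leftObj (X ⊗ Y) ≅ 𝒜.leftObj Y ⊗ 𝒜.leftObj X :=
  rightDualIso (𝒜.leftPairing (X ⊗ Y))
    (@ExactPairing.tensor C _ _ X Y _ _ (𝒜.leftPairing X) (𝒜.leftPairing Y))

/-- The monoidal constraint `(X ⊗ Y)ᵛ ≅ Yᵛ ⊗ Xᵛ` of the right duality functor. -/
def rightTensorIso (X Y : C) : 𝒜.rightObj (X ⊗ Y) ≅ 𝒜.rightObj Y ⊗ 𝒜.rightObj X :=
  leftDualIso (𝒜.rightPairing (X ⊗ Y))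
    (@ExactPairing.tensor C _ _ _ _ Y X (𝒜.rightPairing Y) (𝒜.rightPairing X))

/-- The unit constraint `ᵛI ≅ I` of the left duality functor. -/
def leftUnitIso : 𝒜.leftObj (𝟙_ C) ≅ 𝟙_ C :=
  rightDualIso (𝒜.leftPairing (𝟙_ C)) exactPairingUnit

/-- The unit constraint `Iᵛ ≅ I` of the right duality functor. -/
def rightUnitIso : 𝒜.rightObj (𝟙_ C) ≅ 𝟙_ C :=
  leftDualIso (𝒜.rightPairing (𝟙_ C)) exactPairingUnit

end AutonomousStructure

/-- A sovereign structure on `C`: an autonomous structure together with an isomorphism of monoidal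
functors `φ` from the right duality functor to the left duality functor, that is, a natural
isomorphism that is compatible with the monoidal and unit constraints. -/
structure SovereignStructure extends AutonomousStructure C where
  /-- the isomorphism, with components `Xᵛ ⟶ ᵛX` -/
  φ : toAutonomousStructure.rightDuality ≅ toAutonomousStructure.leftDuality
  φ_tensor : ∀ X Y : C,
    φ.hom.app (op (X ⊗ Y)) ≫ (toAutonomousStructure.leftTensorIso X Y).hom =
      (toAutonomousStructure.rightTensorIso X Y).hom ≫ (φ.hom.app (op Y) ⊗ₘ φ.hom.app (op X))
  φ_unit : φ.hom.app (op (𝟙_ C)) ≫ toAutonomousStructure.leftUnitIso.hom =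
    toAutonomousStructure.rightUnitIso.hom

section Functor

open Functor.LaxMonoidal Functor.OplaxMonoidal

universe v' u'

variable {C} {D : Type u'} [Category.{v'} D] [MonoidalCategory D]

/-- The image of an exact pairing under a monoidal functor. -/
@[reducible]
def mapExactPairing (F : C ⥤ D) [F.Monoidal] {X Y : C} (p : ExactPairing X Y) :
    ExactPairing (F.obj X) (F.obj Y) where
  coevaluation' := ε F ≫ F.map (η_ X Y) ≫ δ F X Y
  evaluation' := μ F Y X ≫ F.map (ε_ X Y) ≫ η F
  coevaluation_evaluation' := by
    have h : F.map _ = F.map _ := congrArg F.map (ExactPairing.coevaluation_evaluation X Y)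
    rw [F.map_comp, F.map_comp, F.map_comp, Functor.Monoidal.map_whiskerLeft,
      Functor.Monoidal.map_whiskerRight, Functor.Monoidal.map_associator_inv,
      Functor.Monoidal.map_rightUnitor, Functor.Monoidal.map_leftUnitor_inv] at h
    have h2 := congrArg (fun t => F.obj Y ◁ ε F ≫ μ F _ _ ≫ t ≫ δ F _ _ ≫ η F ▷ F.obj Y) h
    simp only [Category.assoc, Functor.Monoidal.μ_δ_assoc, Category.comp_id,
      Functor.Monoidal.whiskerLeft_ε_η_assoc, Functor.Monoidal.whiskerRight_ε_η] at h2
    simp only [MonoidalCategory.whiskerLeft_comp, comp_whiskerRight, Category.assoc]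
    exact h2
  evaluation_coevaluation' := by
    have h : F.map _ = F.map _ := congrArg F.map (ExactPairing.evaluation_coevaluation X Y)
    rw [F.map_comp, F.map_comp, F.map_comp, Functor.Monoidal.map_whiskerLeft,
      Functor.Monoidal.map_whiskerRight, Functor.Monoidal.map_associator,
      Functor.Monoidal.map_leftUnitor, Functor.Monoidal.map_rightUnitor_inv] at h
    have h2 := congrArg (fun t => ε F ▷ F.obj X ≫ μ F _ _ ≫ t ≫ δ F _ _ ≫ F.obj X ◁ η F) h
    simp only [Category.assoc, Functor.Monoidal.μ_δ_assoc, Category.comp_id,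
      Functor.Monoidal.whiskerRight_ε_η_assoc, Functor.Monoidal.whiskerLeft_ε_η] at h2
    simp only [MonoidalCategory.whiskerLeft_comp, comp_whiskerRight, Category.assoc]
    exact h2

/-- The canonical isomorphism `l_X : ᵛ(F X) ≅ F (ᵛX)` between left duals of `F X`. -/
def leftComparison (F : C ⥤ D) [F.Monoidal] (𝒜 : AutonomousStructure C)
    (ℬ : AutonomousStructure D) (X : C) : ℬ.leftObj (F.obj X) ≅ F.obj (𝒜.leftObj X) :=
  rightDualIso (ℬ.leftPairing (F.obj X)) (mapExactPairing F (𝒜.leftPairing X))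

/-- The canonical isomorphism `r_X : (F X)ᵛ ≅ F (Xᵛ)` between right duals of `F X`. -/
def rightComparison (F : C ⥤ D) [F.Monoidal] (𝒜 : AutonomousStructure C)
    (ℬ : AutonomousStructure D) (X : C) : ℬ.rightObj (F.obj X) ≅ F.obj (𝒜.rightObj X) :=
  leftDualIso (ℬ.rightPairing (F.obj X)) (mapExactPairing F (𝒜.rightPairing X))

/-- A monoidal functor `F` between sovereign categories `(C, φ)` and `(D, ψ)` is sovereign if
`F(φ_X) ∘ r_X = l_X ∘ ψ_{F X}` for every object `X`. -/
def IsSovereignFunctor (F : C ⥤ D) [F.Monoidal] (Φ : SovereignStructure C)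
    (Ψ : SovereignStructure D) : Prop :=
  ∀ X : C,
    (rightComparison F Φ.toAutonomousStructure Ψ.toAutonomousStructure X).hom ≫
        F.map (Φ.φ.hom.app (op X)) =
      Ψ.φ.hom.app (op (F.obj X)) ≫
        (leftComparison F Φ.toAutonomousStructure Ψ.toAutonomousStructure X).hom

end Functor

end Categorical

/-! ### Finite-dimensional right comodules over a bialgebra -/

section Comodules

/-- `ρ : V → V ⊗ A` is a right coaction of the coalgebra `A`: it is coassociative and counital. -/
structure IsCoaction {k : Type u} [Field k] {A : Type w} [Ring A] [Bialgebra k A]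
    {V : Type v} [AddCommGroup V] [Module k V] (ρ : V →ₗ[k] V ⊗[k] A) : Prop where
  coassoc : (TensorProduct.assoc k V A A).toLinearMap ∘ₗ ρ.rTensor A ∘ₗ ρ =
    (Coalgebra.comul (R := k) (A := A)).lTensor V ∘ₗ ρ
  counit : (TensorProduct.rid k V).toLinearMap ∘ₗ
    (Coalgebra.counit (R := k) (A := A)).lTensor V ∘ₗ ρ = LinearMap.id

variable {k : Type u} [Field k] {A : Type w} [Ring A] [Bialgebra k A]

section Coactions

variable {V W : Type v} [AddCommGroup V] [Module k V] [AddCommGroup W] [Module k W]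

/-- The diagonal coaction `v ⊗ w ↦ v₀ ⊗ w₀ ⊗ v₁ w₁` on the tensor product. -/
def tensorCoaction (ρ : V →ₗ[k] V ⊗[k] A) (σ : W →ₗ[k] W ⊗[k] A) :
    V ⊗[k] W →ₗ[k] (V ⊗[k] W) ⊗[k] A :=
  (LinearMap.mul' k A).lTensor (V ⊗[k] W) ∘ₗ
    (TensorProduct.tensorTensorTensorComm k V A W A).toLinearMap ∘ₗ TensorProduct.map ρ σ

variable (k A) in
/-- The trivial coaction `c ↦ c ⊗ 1` on `k`. -/
def unitCoaction : k →ₗ[k] k ⊗[k] A :=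
  (TensorProduct.mk k k A).flip 1

lemma unitCoaction_isCoaction : IsCoaction (unitCoaction k A) where
  coassoc := by
    ext
    simp [unitCoaction, Algebra.TensorProduct.one_def]
  counit := by
    ext
    simp [unitCoaction]

lemma tensorCoaction_isCoaction {ρ : V →ₗ[k] V ⊗[k] A} {σ : W →ₗ[k] W ⊗[k] A}
    (hρ : IsCoaction ρ) (hσ : IsCoaction σ) : IsCoaction (tensorCoaction ρ σ) where
  coassoc := by
    have key : ∀ (x : V ⊗[k] A) (y : W ⊗[k] A),
        TensorProduct.assoc k (V ⊗[k] W) A A ((tensorCoaction ρ σ).rTensor A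
          ((LinearMap.mul' k A).lTensor (V ⊗[k] W)
            (TensorProduct.tensorTensorTensorComm k V A W A (x ⊗ₜ y)))) =
        (LinearMap.mul' k (A ⊗[k] A)).lTensor (V ⊗[k] W)
          (TensorProduct.tensorTensorTensorComm k V (A ⊗[k] A) W (A ⊗[k] A)
            (TensorProduct.assoc k V A A (ρ.rTensor A x) ⊗ₜ
              TensorProduct.assoc k W A A (σ.rTensor A y))) := by
      intro x y
      induction x with
      | zero => simp
      | add x₁ x₂ h₁ h₂ => simp only [TensorProduct.add_tmul, map_add, h₁, h₂]
      | tmul v a =>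
        induction y with
        | zero => simp
        | add y₁ y₂ h₁ h₂ => simp only [TensorProduct.tmul_add, map_add, h₁, h₂]
        | tmul w b =>
          simp only [LinearMap.rTensor_tmul, TensorProduct.tensorTensorTensorComm_tmul,
            LinearMap.lTensor_tmul, LinearMap.mul'_apply, tensorCoaction, LinearMap.comp_apply,
            TensorProduct.map_tmul, LinearEquiv.coe_coe]
          generalize ρ v = x
          generalize σ w = y
          induction x with
          | zero => simp
          | add x₁ x₂ h₁ h₂ => simp only [TensorProduct.add_tmul, map_add, h₁, h₂]
          | tmul v' a' =>
            induction y with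
            | zero => simp
            | add y₁ y₂ h₁ h₂ =>
              simp only [TensorProduct.tmul_add, TensorProduct.add_tmul, map_add, h₁, h₂]
            | tmul w' b' => simp
    have key2 : ∀ (x : V ⊗[k] A) (y : W ⊗[k] A),
        (Coalgebra.comul (R := k) (A := A)).lTensor (V ⊗[k] W)
          ((LinearMap.mul' k A).lTensor (V ⊗[k] W)
            (TensorProduct.tensorTensorTensorComm k V A W A (x ⊗ₜ y))) =
        (LinearMap.mul' k (A ⊗[k] A)).lTensor (V ⊗[k] W)
          (TensorProduct.tensorTensorTensorComm k V (A ⊗[k] A) W (A ⊗[k] A)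
            ((Coalgebra.comul (R := k) (A := A)).lTensor V x ⊗ₜ
              (Coalgebra.comul (R := k) (A := A)).lTensor W y)) := by
      intro x y
      induction x with
      | zero => simp
      | add x₁ x₂ h₁ h₂ => simp only [TensorProduct.add_tmul, map_add, h₁, h₂]
      | tmul v a =>
        induction y with
        | zero => simp
        | add y₁ y₂ h₁ h₂ => simp only [TensorProduct.tmul_add, map_add, h₁, h₂]
        | tmul w b => simp
    refine TensorProduct.ext' fun v w => ?_
    have h₁ := LinearMap.congr_fun hρ.coassoc v
    have h₂ := LinearMap.congr_fun hσ.coassoc w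
    simp only [LinearMap.comp_apply, LinearEquiv.coe_coe] at h₁ h₂
    have e₁ := key (ρ v) (σ w)
    have e₂ := key2 (ρ v) (σ w)
    rw [h₁, h₂, ← e₂] at e₁
    exact e₁
  counit := by
    have key : ∀ (x : V ⊗[k] A) (y : W ⊗[k] A),
        TensorProduct.rid k (V ⊗[k] W)
          ((Coalgebra.counit (R := k) (A := A)).lTensor (V ⊗[k] W)
            ((LinearMap.mul' k A).lTensor (V ⊗[k] W)
              (TensorProduct.tensorTensorTensorComm k V A W A (x ⊗ₜ y)))) =
        TensorProduct.rid k V ((Coalgebra.counit (R := k) (A := A)).lTensor V x) ⊗ₜ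
          TensorProduct.rid k W ((Coalgebra.counit (R := k) (A := A)).lTensor W y) := by
      intro x y
      induction x with
      | zero => simp
      | add x₁ x₂ h₁ h₂ => simp only [TensorProduct.add_tmul, map_add, h₁, h₂]
      | tmul v a =>
        induction y with
        | zero => simp
        | add y₁ y₂ h₁ h₂ => simp only [TensorProduct.tmul_add, map_add, h₁, h₂]
        | tmul w b =>
          simp only [LinearMap.lTensor_tmul, TensorProduct.tensorTensorTensorComm_tmul,
            LinearMap.mul'_apply, Bialgebra.counit_mul, TensorProduct.rid_tmul,
            TensorProduct.smul_tmul_smul]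
    refine TensorProduct.ext' fun v w => ?_
    have h₁ := LinearMap.congr_fun hρ.counit v
    have h₂ := LinearMap.congr_fun hσ.counit w
    simp only [LinearMap.comp_apply, LinearEquiv.coe_coe] at h₁ h₂
    have e₁ := key (ρ v) (σ w)
    rw [h₁, h₂] at e₁
    exact e₁

lemma tensorCoaction_map {V' W' : Type v} [AddCommGroup V'] [Module k V'] [AddCommGroup W']
    [Module k W'] {ρ : V →ₗ[k] V ⊗[k] A} {σ : W →ₗ[k] W ⊗[k] A}
    {ρ' : V' →ₗ[k] V' ⊗[k] A} {σ' : W' →ₗ[k] W' ⊗[k] A} {f : V →ₗ[k] V'} {g : W →ₗ[k] W'}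
    (hf : ρ' ∘ₗ f = f.rTensor A ∘ₗ ρ) (hg : σ' ∘ₗ g = g.rTensor A ∘ₗ σ) :
    tensorCoaction ρ' σ' ∘ₗ TensorProduct.map f g =
      (TensorProduct.map f g).rTensor A ∘ₗ tensorCoaction ρ σ := by
  refine TensorProduct.ext' fun v w => ?_
  have h₁ := LinearMap.congr_fun hf v
  have h₂ := LinearMap.congr_fun hg w
  simp only [LinearMap.comp_apply] at h₁ h₂
  simp only [tensorCoaction, LinearMap.comp_apply, TensorProduct.map_tmul, h₁, h₂]
  generalize ρ v = x
  generalize σ w = y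
  induction x with
  | zero => simp
  | add x₁ x₂ h₁ h₂ => simp only [TensorProduct.add_tmul, map_add, h₁, h₂]
  | tmul v a =>
    induction y with
    | zero => simp
    | add y₁ y₂ h₁ h₂ => simp only [TensorProduct.tmul_add, map_add, h₁, h₂]
    | tmul w b => simp

lemma tensorCoaction_assoc {Z : Type v} [AddCommGroup Z] [Module k Z]
    (ρ : V →ₗ[k] V ⊗[k] A) (σ : W →ₗ[k] W ⊗[k] A) (τ : Z →ₗ[k] Z ⊗[k] A) :
    tensorCoaction ρ (tensorCoaction σ τ) ∘ₗ (TensorProduct.assoc k V W Z).toLinearMap =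
      (TensorProduct.assoc k V W Z).toLinearMap.rTensor A ∘ₗ
        tensorCoaction (tensorCoaction ρ σ) τ := by
  refine TensorProduct.ext_threefold fun v w z => ?_
  simp only [tensorCoaction, LinearMap.comp_apply, TensorProduct.map_tmul,
    LinearEquiv.coe_coe, TensorProduct.assoc_tmul]
  generalize ρ v = x
  generalize σ w = y
  generalize τ z = t
  induction x with
  | zero => simp
  | add x₁ x₂ h₁ h₂ => simp only [TensorProduct.add_tmul, map_add, h₁, h₂]
  | tmul v a =>
    induction y with
    | zero => simp
    | add y₁ y₂ h₁ h₂ =>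
      simp only [TensorProduct.tmul_add, TensorProduct.add_tmul, map_add, h₁, h₂]
    | tmul w b =>
      induction t with
      | zero => simp
      | add y₁ y₂ h₁ h₂ => simp only [TensorProduct.tmul_add, map_add, h₁, h₂]
      | tmul z c => simp [mul_assoc]

lemma tensorCoaction_lid {U : Type u} [AddCommGroup U] [Module k U] (ρ : U →ₗ[k] U ⊗[k] A) :
    ρ ∘ₗ (TensorProduct.lid k U).toLinearMap =
      (TensorProduct.lid k U).toLinearMap.rTensor A ∘ₗ tensorCoaction (unitCoaction k A) ρ := by
  refine TensorProduct.ext' fun c v => ?_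
  simp only [unitCoaction, tensorCoaction, LinearMap.comp_apply,
    TensorProduct.map_tmul, LinearEquiv.coe_coe, TensorProduct.lid_tmul, map_smul]
  generalize ρ v = x
  induction x with
  | zero => simp
  | add x₁ x₂ h₁ h₂ => simp only [TensorProduct.tmul_add, map_add, smul_add, h₁, h₂]
  | tmul v a => simp [TensorProduct.smul_tmul']

lemma tensorCoaction_rid {U : Type u} [AddCommGroup U] [Module k U] (ρ : U →ₗ[k] U ⊗[k] A) :
    ρ ∘ₗ (TensorProduct.rid k U).toLinearMap =
      (TensorProduct.rid k U).toLinearMap.rTensor A ∘ₗ tensorCoaction ρ (unitCoaction k A) := by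
  refine TensorProduct.ext' fun v c => ?_
  simp only [unitCoaction, tensorCoaction, LinearMap.comp_apply,
    TensorProduct.map_tmul, LinearEquiv.coe_coe, TensorProduct.rid_tmul, map_smul]
  generalize ρ v = x
  induction x with
  | zero => simp
  | add x₁ x₂ h₁ h₂ => simp only [TensorProduct.add_tmul, map_add, smul_add, h₁, h₂]
  | tmul v a => simp [TensorProduct.smul_tmul']

end Coactions

variable (k A) in
/-- The objects of `Co_f(A)`: finite-dimensional right `A`-comodules. -/
structure FinComod where
  /-- the underlying vector space -/
  carrier : Type u
  [addCommGroup : AddCommGroup carrier]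
  [module : Module k carrier]
  [finite : Module.Finite k carrier]
  /-- the coaction -/
  coact : carrier →ₗ[k] carrier ⊗[k] A
  isCoaction : IsCoaction coact

namespace FinComod

attribute [instance] FinComod.addCommGroup FinComod.module FinComod.finite

/-- Morphisms of comodules: linear maps that commute with the coactions. -/
@[ext]
structure Hom (X Y : FinComod k A) where
  /-- the underlying linear map -/
  lin : X.carrier →ₗ[k] Y.carrier
  comm : Y.coact ∘ₗ lin = lin.rTensor A ∘ₗ X.coact

instance : Category (FinComod k A) where
  Hom := Hom
  id X := ⟨LinearMap.id, by simp⟩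
  comp f g := ⟨g.lin ∘ₗ f.lin, by
    rw [← LinearMap.comp_assoc, g.comm, LinearMap.comp_assoc, f.comm, ← LinearMap.comp_assoc,
      LinearMap.rTensor_comp]⟩

/-- The linear map underlying a morphism. -/
def linMap {X Y : FinComod k A} (f : X ⟶ Y) : X.carrier →ₗ[k] Y.carrier := Hom.lin f

lemma linMap_comm {X Y : FinComod k A} (f : X ⟶ Y) :
    Y.coact ∘ₗ linMap f = (linMap f).rTensor A ∘ₗ X.coact := Hom.comm f

lemma hom_ext {X Y : FinComod k A} {f g : X ⟶ Y} (h : linMap f = linMap g) : f = g :=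
  Hom.ext h

/-- A bijective comodule morphism is an isomorphism of comodules. -/
def isoMk {X Y : FinComod k A} (e : X.carrier ≃ₗ[k] Y.carrier)
    (h : Y.coact ∘ₗ e.toLinearMap = e.toLinearMap.rTensor A ∘ₗ X.coact) : X ≅ Y where
  hom := ⟨e.toLinearMap, h⟩
  inv := ⟨e.symm.toLinearMap, by
    have h' := congrArg (fun t => e.symm.toLinearMap.rTensor A ∘ₗ t ∘ₗ e.symm.toLinearMap) h
    simp only [LinearMap.comp_assoc, LinearEquiv.comp_symm, LinearMap.comp_id] at h'
    rw [h', ← LinearMap.comp_assoc, ← LinearMap.rTensor_comp]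
    simp⟩
  hom_inv_id := Hom.ext (by ext x; exact e.symm_apply_apply x)
  inv_hom_id := Hom.ext (by ext x; exact e.apply_symm_apply x)

variable (k A) in
/-- The forgetful functor `Co_f(A) ⥤ Vect_f(k)`. -/
def forgetful : FinComod k A ⥤ FGModuleCat.{u} k where
  obj X := FGModuleCat.of k X.carrier
  map f := FGModuleCat.ofHom (linMap f)

instance : (forgetful k A).Faithful where
  map_injective h := hom_ext (congrArg (fun t => t.hom.hom) h)

/-- The tensor product of comodules. -/
def tensor (X Y : FinComod k A) : FinComod k A where
  carrier := X.carrier ⊗[k] Y.carrier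
  coact := tensorCoaction X.coact Y.coact
  isCoaction := tensorCoaction_isCoaction X.isCoaction Y.isCoaction

variable (k A) in
/-- The trivial comodule. -/
def unit : FinComod k A where
  carrier := k
  coact := unitCoaction k A
  isCoaction := unitCoaction_isCoaction

/-- The tensor product of comodule morphisms. -/
def tensorMap {X₁ Y₁ X₂ Y₂ : FinComod k A} (f : X₁ ⟶ Y₁) (g : X₂ ⟶ Y₂) :
    tensor X₁ X₂ ⟶ tensor Y₁ Y₂ where
  lin := TensorProduct.map (linMap f) (linMap g)
  comm := tensorCoaction_map (linMap_comm f) (linMap_comm g)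

/-- The associativity constraint, given by that of vector spaces. -/
def assocIso (X Y Z : FinComod k A) : tensor (tensor X Y) Z ≅ tensor X (tensor Y Z) :=
  isoMk (TensorProduct.assoc k X.carrier Y.carrier Z.carrier)
    (tensorCoaction_assoc X.coact Y.coact Z.coact)

/-- The left unit constraint, given by that of vector spaces. -/
def leftUnitIso (X : FinComod k A) : tensor (unit k A) X ≅ X :=
  isoMk (TensorProduct.lid k X.carrier)
    (tensorCoaction_lid X.coact)

/-- The right unit constraint, given by that of vector spaces. -/
def rightUnitIso (X : FinComod k A) : tensor X (unit k A) ≅ X :=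
  isoMk (TensorProduct.rid k X.carrier)
    (tensorCoaction_rid X.coact)

instance : MonoidalCategoryStruct (FinComod k A) where
  tensorObj := tensor
  whiskerLeft X _ _ f := tensorMap (𝟙 X) f
  whiskerRight f Y := tensorMap f (𝟙 Y)
  tensorHom := tensorMap
  tensorUnit := unit k A
  associator := assocIso
  leftUnitor := leftUnitIso
  rightUnitor := rightUnitIso

variable (k A) in
/-- The forgetful functor preserves all the data of the monoidal structures on the nose. -/
def forgetfulData : Monoidal.InducingFunctorData (forgetful k A) where
  μIso X Y := Iso.refl _
  εIso := Iso.refl _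
  whiskerLeft_eq X Y₁ Y₂ f := by
    apply FGModuleCat.hom_ext
    rfl
  whiskerRight_eq f Y := by
    apply FGModuleCat.hom_ext
    rfl
  tensorHom_eq f g := by
    apply FGModuleCat.hom_ext
    rfl
  associator_eq X Y Z := by
    apply FGModuleCat.hom_ext
    refine TensorProduct.ext_threefold fun v w z => ?_
    rfl
  leftUnitor_eq X := by
    apply FGModuleCat.hom_ext
    refine TensorProduct.ext' fun v w => ?_
    rfl
  rightUnitor_eq X := by
    apply FGModuleCat.hom_ext
    refine TensorProduct.ext' fun v w => ?_
    rfl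

/-- The monoidal category `Co_f(A)`. -/
instance : MonoidalCategory (FinComod k A) :=
  Monoidal.induced (forgetful k A) (forgetfulData k A)

/-- The forgetful functor is monoidal, with identities as structure morphisms. -/
instance : (forgetful k A).Monoidal :=
  Monoidal.fromInducedMonoidal (forgetful k A) (forgetfulData k A)

end FinComod

end Comodules

/-! ### Sovereign characters -/

section Characters

open WithConv

variable {k : Type u} [Field k] {A : Type w} [Ring A] [HopfAlgebra k A]

/-- A linear form on `A` as an element of the convolution algebra `Hom(A, A)`, through the unit
`k → A`. -/
def convForm (f : A →ₗ[k] k) : WithConv (A →ₗ[k] A) :=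
  toConv (Algebra.linearMap k A ∘ₗ f)

/-- The convolution inverse `Φ⁻¹ = Φ ∘ S` of a character `Φ`. -/
def charInv (Φ : A →ₐ[k] k) : A →ₗ[k] k := Φ.toLinearMap ∘ₗ HopfAlgebra.antipode k

lemma char_mul_charInv (Φ : A →ₐ[k] k) : toConv Φ.toLinearMap * toConv (charInv Φ) = 1 := by
  ext a
  rw [(Coalgebra.Repr.arbitrary k a).convMul_apply]
  have h := congrArg Φ
    (HopfAlgebra.sum_mul_antipode_eq_algebraMap_counit (Coalgebra.Repr.arbitrary k a))
  simpa [charInv] using h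

lemma charInv_mul_char (Φ : A →ₐ[k] k) : toConv (charInv Φ) * toConv Φ.toLinearMap = 1 := by
  ext a
  rw [(Coalgebra.Repr.arbitrary k a).convMul_apply]
  have h := congrArg Φ
    (HopfAlgebra.sum_antipode_mul_eq_algebraMap_counit (Coalgebra.Repr.arbitrary k a))
  simpa [charInv] using h

/-- A sovereign character on a Hopf algebra with bijective antipode `S`: a character `Φ` such that
`S⁻¹ = Φ * S * Φ⁻¹` for the convolution product. -/
def IsSovereignCharacter (hS : Function.Bijective (HopfAlgebra.antipode k (A := A)))
    (Φ : A →ₐ[k] k) : Prop :=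
  toConv (LinearEquiv.ofBijective (HopfAlgebra.antipode k (A := A)) hS).symm.toLinearMap =
    convForm Φ.toLinearMap * toConv (HopfAlgebra.antipode k (A := A)) * convForm (charInv Φ)

end Characters

end

/-! Evaluations of duals are perfect pairings of the underlying vector spaces. Hence a morphism `f :
Xᵛ ⟶ ᵛX` amounts to a linear endomorphism `θ` of `X` with `⟨f ξ, x⟩ = ⟨θ x, ξ⟩` (`Corresponds`).
Under this dictionary, naturality and monoidality of a sovereign structure say exactly that `θ` is a
monoidal natural endomorphism of the forgetful functor. By Tannaka reconstruction
(`FinComod.exists_character`), `θ` is then the action `x ↦ Φ(x₁) x₀` of a character `Φ`.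

What remains is the colinearity of `f`. Let `M` be the matrix of `X` in a basis and `N` that of `Xᵛ`
in the dual basis. Invariance of the right evaluation reads `Mᵀ N = 1`, so `S(Nᵀ) = M`. Colinearity
of `f` reads `Nᵀ Φ(M) M = Φ(M)`, that is, `Nᵀ = Φ(M) S(M) Φ(S M) = (Φ * S * Φ⁻¹)(M)`. Since the
entries of such `M` span `A`, colinearity for all `X` gives `S ∘ (Φ * S * Φ⁻¹) = id`
(`antipode_comp_conjAntipode`); the converse needs `S` injective (`exists_hom_corresponds`). For
bijective `S` this is the definition of a sovereign character, and duals exist: they have matrices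
`S(M)ᵀ` and `S⁻¹(M)ᵀ`.

For the second part, naturality along maps `I ⟶ V` forces every sovereign structure on vector spaces
to be the canonical one. So the forgetful functor is sovereign if and only if every `θ` is the
identity (`isSovereignFunctor_forgetful_iff`). The identity is the action of the counit, for which
the equation becomes `S ∘ S = id`. -/

noncomputable section

/-! ### Evaluations and the duality functors -/

section Evaluations

variable {C : Type u} [Category.{v} C] [MonoidalCategory C]

/-- The comparison of two duals is the transpose of `𝟙 X`, so this is the characteristic property of
transposes. The canonical isomorphisms between left duals are used below only through it, and those
between right duals through its mirror image. -/
lemma rightDualIso_hom_comp_evaluation {X Y₁ Y₂ : C} (p₁ : ExactPairing X Y₁)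
    (p₂ : ExactPairing X Y₂) :
    (rightDualIso p₁ p₂).hom ▷ X ≫ p₂.evaluation = p₁.evaluation := by
  have h := @rightAdjointMate_comp_evaluation C _ _ X X ⟨Y₂⟩ ⟨Y₁⟩ (𝟙 X)
  rwa [whiskerLeft_id, Category.id_comp] at h

lemma leftDualIso_hom_comp_evaluation {X₁ X₂ Y : C} (p₁ : ExactPairing X₁ Y)
    (p₂ : ExactPairing X₂ Y) :
    Y ◁ (leftDualIso p₁ p₂).hom ≫ p₂.evaluation = p₁.evaluation := by
  have h := @leftAdjointMate_comp_evaluation C _ _ Y Y ⟨X₂⟩ ⟨X₁⟩ (𝟙 Y)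
  rwa [id_whiskerRight, Category.id_comp] at h

/-- A pairing `Z ⊗ X ⟶ I` factors through the evaluation of a left dual of `X`. -/
lemma exists_whiskerRight_comp_evaluation {X Y Z : C} (p : ExactPairing X Y)
    (t : Z ⊗ X ⟶ 𝟙_ C) : ∃ f : Z ⟶ Y, f ▷ X ≫ p.evaluation = t := by
  -- The adjunct of `t` under `- ⊗ X ⊣ - ⊗ Y`, with `I ⊗ Y` identified with `Y`.
  refine ⟨tensorRightHomEquiv Z X Y (𝟙_ C) t ≫ (λ_ Y).hom, ?_⟩
  have h := (tensorRightHomEquiv Z X Y (𝟙_ C)).symm_apply_apply t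
  rw [← h]
  simp only [Equiv.apply_symm_apply]
  change _ = _ ▷ X ≫ (α_ _ _ _).hom ≫ _ ◁ p.evaluation ≫ (ρ_ _).hom
  rw [comp_whiskerRight, Category.assoc]
  congr 1
  rw [leftUnitor_whiskerRight, Category.assoc, ← leftUnitor_naturality, unitors_equal]

namespace AutonomousStructure

variable (𝒜 : AutonomousStructure C)

/-- The evaluation `ᵛX ⊗ X ⟶ I`. -/
def leftEval (X : C) : 𝒜.leftObj X ⊗ X ⟶ 𝟙_ C := (𝒜.leftPairing X).evaluation

/-- The evaluation `X ⊗ Xᵛ ⟶ I`. -/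
def rightEval (X : C) : X ⊗ 𝒜.rightObj X ⟶ 𝟙_ C := (𝒜.rightPairing X).evaluation

/-- The left transpose of a morphism. -/
def leftMap {X Y : C} (f : X ⟶ Y) : 𝒜.leftObj Y ⟶ 𝒜.leftObj X := 𝒜.leftDuality.map f.op

/-- The right transpose of a morphism. -/
def rightMap {X Y : C} (f : X ⟶ Y) : 𝒜.rightObj Y ⟶ 𝒜.rightObj X := 𝒜.rightDuality.map f.op

lemma leftMap_comp_leftEval {X Y : C} (f : X ⟶ Y) :
    𝒜.leftMap f ▷ X ≫ 𝒜.leftEval X = 𝒜.leftObj Y ◁ f ≫ 𝒜.leftEval Y :=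
  @rightAdjointMate_comp_evaluation C _ _ X Y (𝒜.left _) (𝒜.left _) f

lemma rightMap_comp_rightEval {X Y : C} (f : X ⟶ Y) :
    X ◁ 𝒜.rightMap f ≫ 𝒜.rightEval X = f ▷ 𝒜.rightObj Y ≫ 𝒜.rightEval Y :=
  @leftAdjointMate_comp_evaluation C _ _ X Y (𝒜.right _) (𝒜.right _) f

/-- The evaluation of a tensor product of left duals, with explicit associators. -/
lemma leftTensorIso_comp_eval (X Y : C) :
    (𝒜.leftTensorIso X Y).hom ▷ (X ⊗ Y) ≫ (α_ _ _ _).hom ≫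
      𝒜.leftObj Y ◁ ((α_ _ _ _).inv ≫ 𝒜.leftEval X ▷ Y ≫ (λ_ Y).hom) ≫ 𝒜.leftEval Y =
    𝒜.leftEval (X ⊗ Y) := by
  refine Eq.trans ?_ (rightDualIso_hom_comp_evaluation (𝒜.leftPairing (X ⊗ Y))
    (@ExactPairing.tensor C _ _ X Y _ _ (𝒜.leftPairing X) (𝒜.leftPairing Y)))
  congr 1
  rw [@ExactPairing.tensor_evaluation]
  simp [monoidalComp, leftEval]

/-- The evaluation of a tensor product of right duals, with explicit associators. -/
lemma rightTensorIso_comp_eval (X Y : C) :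
    (X ⊗ Y) ◁ (𝒜.rightTensorIso X Y).hom ≫ (α_ _ _ _).hom ≫
      X ◁ ((α_ _ _ _).inv ≫ 𝒜.rightEval Y ▷ _ ≫ (λ_ _).hom) ≫ 𝒜.rightEval X =
    𝒜.rightEval (X ⊗ Y) := by
  refine Eq.trans ?_ (leftDualIso_hom_comp_evaluation (𝒜.rightPairing (X ⊗ Y))
    (@ExactPairing.tensor C _ _ _ _ Y X (𝒜.rightPairing Y) (𝒜.rightPairing X)))
  congr 1
  rw [@ExactPairing.tensor_evaluation]
  simp [monoidalComp, rightEval]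

lemma leftUnitIso_comp_eval :
    𝒜.leftUnitIso.hom ▷ 𝟙_ C ≫ (ρ_ (𝟙_ C)).hom = 𝒜.leftEval (𝟙_ C) :=
  rightDualIso_hom_comp_evaluation (𝒜.leftPairing (𝟙_ C)) exactPairingUnit

lemma rightUnitIso_comp_eval :
    𝟙_ C ◁ 𝒜.rightUnitIso.hom ≫ (ρ_ (𝟙_ C)).hom = 𝒜.rightEval (𝟙_ C) :=
  leftDualIso_hom_comp_evaluation (𝒜.rightPairing (𝟙_ C)) exactPairingUnit

end AutonomousStructure

namespace SovereignStructure

variable (𝒮 : SovereignStructure C)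

/-- The component `Xᵛ ⟶ ᵛX` of the isomorphism of a sovereign structure. -/
def component (X : C) : 𝒮.rightObj X ⟶ 𝒮.leftObj X := 𝒮.φ.hom.app (op X)

lemma component_naturality {X Y : C} (f : X ⟶ Y) :
    𝒮.rightMap f ≫ 𝒮.component X = 𝒮.component Y ≫ 𝒮.leftMap f :=
  𝒮.φ.hom.naturality f.op

lemma component_tensor (X Y : C) :
    𝒮.component (X ⊗ Y) ≫ (𝒮.leftTensorIso X Y).hom =
      (𝒮.rightTensorIso X Y).hom ≫ (𝒮.component Y ⊗ₘ 𝒮.component X) :=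
  𝒮.φ_tensor X Y

lemma component_unit :
    𝒮.component (𝟙_ C) ≫ 𝒮.leftUnitIso.hom = 𝒮.rightUnitIso.hom :=
  𝒮.φ_unit

end SovereignStructure

/-- In an autonomous category the duals can be chosen so that the unit is its own dual. -/
lemma IsAutonomous.nonempty_autonomousStructure (h : IsAutonomous C) :
    Nonempty (AutonomousStructure C) := by
  classical
  exact ⟨{
    left := fun X => if e : X = 𝟙_ C then e ▸ hasRightDualUnit else (h X).1.some
    right := fun X => if e : X = 𝟙_ C then e ▸ hasLeftDualUnit else (h X).2.some
    left_unit := by simp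
    right_unit := by simp }⟩

end Evaluations

/-! ### Bilinear forms of pairings of vector spaces -/

namespace FGModuleCat

variable {k : Type u} [Field k]

/-- The linear map underlying a morphism of finite-dimensional vector spaces. -/
def lin {V W : FGModuleCat.{u} k} (f : V ⟶ W) : V →ₗ[k] W := f.hom.hom

lemma lin_comp {U V W : FGModuleCat.{u} k} (f : U ⟶ V) (g : V ⟶ W) (x : U) :
    lin (f ≫ g) x = lin g (lin f x) := rfl

/-- The bilinear form of a morphism `V ⊗ W ⟶ I` of finite-dimensional vector spaces. -/
def form {V W : FGModuleCat.{u} k} (e : V ⊗ W ⟶ 𝟙_ (FGModuleCat.{u} k)) : V →ₗ[k] W →ₗ[k] k :=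
  TensorProduct.curry (lin e : V ⊗[k] W →ₗ[k] k)

lemma form_whiskerRight {V V' W : FGModuleCat.{u} k} (f : V ⟶ V')
    (e : V' ⊗ W ⟶ 𝟙_ (FGModuleCat.{u} k)) (x : V) (y : W) :
    form (f ▷ W ≫ e) x y = form e (lin f x) y := rfl

lemma form_whiskerLeft {V W W' : FGModuleCat.{u} k} (f : W ⟶ W')
    (e : V ⊗ W' ⟶ 𝟙_ (FGModuleCat.{u} k)) (x : V) (y : W) :
    form (V ◁ f ≫ e) x y = form e x (lin f y) := rfl

lemma form_rightUnitor_comm (x y : (𝟙_ (FGModuleCat.{u} k) : FGModuleCat.{u} k)) :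
    form (ρ_ (𝟙_ (FGModuleCat.{u} k))).hom x y = form (ρ_ (𝟙_ (FGModuleCat.{u} k))).hom y x :=
  mul_comm (G := k) y x

/-- A triangle identity recovers `y` from `y ⊗ coev(1)` by a map that sees `y` only through its
form; if the form vanishes, so does `y`. The flipped version uses the other triangle identity. -/
lemma form_evaluation_injective {V W : FGModuleCat.{u} k} (p : ExactPairing V W) :
    Function.Injective (form p.evaluation) := by
  refine (injective_iff_map_eq_zero _).2 fun y hy => ?_
  have hl : ∀ c : V ⊗[k] W,
      lin ((α_ W V W).inv ≫ p.evaluation ▷ W ≫ (λ_ W).hom) (y ⊗ₜ[k] c) = (0 : W) := by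
    intro c
    induction c with
    | zero => rw [TensorProduct.tmul_zero]; exact map_zero _
    | add c d hc hd =>
      rw [TensorProduct.tmul_add]
      exact (map_add _ _ _).trans (by rw [hc, hd, add_zero])
    | tmul v z =>
      change (form p.evaluation y v) • z = 0
      rw [hy, LinearMap.zero_apply, zero_smul]
  have h : W ◁ p.coevaluation ≫ (α_ W V W).inv ≫ p.evaluation ▷ W ≫ (λ_ W).hom = (ρ_ W).hom := by
    rw [p.coevaluation_evaluation_assoc, Iso.inv_hom_id, Category.comp_id]
  have h₁ : lin (ρ_ W).hom (y ⊗ₜ[k] (1 : k)) = y := one_smul k y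
  rw [← h₁, ← h]
  exact hl _

lemma form_evaluation_flip_injective {V W : FGModuleCat.{u} k} (p : ExactPairing V W) :
    Function.Injective (form p.evaluation).flip := by
  refine (injective_iff_map_eq_zero _).2 fun y hy => ?_
  have hl : ∀ c : V ⊗[k] W,
      lin ((α_ V W V).hom ≫ V ◁ p.evaluation ≫ (ρ_ V).hom) (c ⊗ₜ[k] y) = (0 : V) := by
    intro c
    induction c with
    | zero => rw [TensorProduct.zero_tmul]; exact map_zero _
    | add c d hc hd =>
      rw [TensorProduct.add_tmul]
      exact (map_add _ _ _).trans (by rw [hc, hd, add_zero])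
    | tmul v z =>
      change (form p.evaluation).flip y z • v = 0
      rw [hy, LinearMap.zero_apply, zero_smul]
  have h : p.coevaluation ▷ V ≫ (α_ V W V).hom ≫ V ◁ p.evaluation ≫ (ρ_ V).hom = (λ_ V).hom := by
    rw [p.evaluation_coevaluation_assoc, Iso.inv_hom_id, Category.comp_id]
  have h₁ : lin (λ_ V).hom ((1 : k) ⊗ₜ[k] y) = y := one_smul k y
  rw [← h₁, ← h]
  exact hl _

/-- The category of finite-dimensional vector spaces has only the trivial sovereign structure:
the isomorphism between right and left duals is the canonical one. -/
lemma form_leftEval_component (ψ : SovereignStructure (FGModuleCat.{u} k)) (V : FGModuleCat.{u} k)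
    (ξ : ψ.rightObj V) (x : V) :
    form (ψ.leftEval V) (lin (ψ.component V) ξ) x = form (ψ.rightEval V) x ξ := by
  -- The vector `x` is the image of `1` under a map `f : I ⟶ V`. Naturality in `f` reduces the claim
  -- to `V = I`, where it is the unit condition.
  let e : (𝟙_ (FGModuleCat.{u} k) : FGModuleCat.{u} k) := (1 : k)
  let f : 𝟙_ (FGModuleCat.{u} k) ⟶ V := FGModuleCat.ofHom (LinearMap.toSpanSingleton k V x)
  have hf : lin f e = x := one_smul k x
  have h₁ : ∀ η : ψ.rightObj (𝟙_ (FGModuleCat.{u} k)),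
      form (ψ.leftEval (𝟙_ _)) (lin (ψ.component (𝟙_ _)) η) e =
        form (ψ.rightEval (𝟙_ _)) e η := by
    intro η
    rw [← ψ.leftUnitIso_comp_eval, ← ψ.rightUnitIso_comp_eval, form_whiskerRight,
      form_whiskerLeft, ← ψ.component_unit, form_rightUnitor_comm, lin_comp]
  rw [← hf, ← form_whiskerLeft, ← ψ.leftMap_comp_leftEval, form_whiskerRight (ψ.leftMap f),
    ← form_whiskerRight f, ← ψ.rightMap_comp_rightEval, form_whiskerLeft, ← h₁, ← lin_comp,
    ← lin_comp, ψ.component_naturality]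

lemma hom_ext_leftEval (𝒜 : AutonomousStructure (FGModuleCat.{u} k)) {V Z : FGModuleCat.{u} k}
    {f g : Z ⟶ 𝒜.leftObj V}
    (h : ∀ z x, form (𝒜.leftEval V) (lin f z) x = form (𝒜.leftEval V) (lin g z) x) : f = g :=
  hom_ext (LinearMap.ext fun z =>
    form_evaluation_injective (𝒜.leftPairing V) (LinearMap.ext (h z)))

/-- The form of a nested pairing is the product of the forms. -/
lemma form_nested {V₁ V₂ W₁ W₂ : FGModuleCat.{u} k} (e₁ : W₁ ⊗ V₁ ⟶ 𝟙_ (FGModuleCat.{u} k))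
    (e₂ : W₂ ⊗ V₂ ⟶ 𝟙_ (FGModuleCat.{u} k)) (x₁ : V₁) (x₂ : V₂) (y₁ : W₁) (y₂ : W₂) :
    form ((α_ W₂ W₁ (V₁ ⊗ V₂)).hom ≫ W₂ ◁ ((α_ W₁ V₁ V₂).inv ≫ e₁ ▷ V₂ ≫ (λ_ V₂).hom) ≫ e₂)
      (y₂ ⊗ₜ[k] y₁ : W₂ ⊗[k] W₁) (x₁ ⊗ₜ[k] x₂ : V₁ ⊗[k] V₂) =
      form e₁ y₁ x₁ * form e₂ y₂ x₂ := by
  change form e₂ y₂ (form e₁ y₁ x₁ • x₂) = _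
  rw [map_smul, smul_eq_mul]

/-- The category of finite-dimensional vector spaces has a sovereign structure. -/
theorem nonempty_sovereignStructure : Nonempty (SovereignStructure (FGModuleCat.{u} k)) := by
  have hA : IsAutonomous (FGModuleCat.{u} k) := fun V =>
    ⟨⟨inferInstance⟩, ⟨BraidedCategory.hasLeftDualOfHasRightDual⟩⟩
  obtain ⟨𝒜⟩ := hA.nonempty_autonomousStructure
  -- The symmetry turns a right dual into a left dual, and any two left duals are canonically
  -- isomorphic.
  let i : ∀ V, 𝒜.rightObj V ≅ 𝒜.leftObj V := fun V => rightDualIso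
    (@BraidedCategory.exactPairing_swap _ _ _ _ _ _ (𝒜.rightPairing V)) (𝒜.leftPairing V)
  have hi : ∀ V ξ x, form (𝒜.leftEval V) (lin (i V).hom ξ) x = form (𝒜.rightEval V) x ξ :=
    fun V ξ x => congrArg (fun t => form t ξ x) (rightDualIso_hom_comp_evaluation
      (@BraidedCategory.exactPairing_swap _ _ _ _ _ _ (𝒜.rightPairing V)) (𝒜.leftPairing V))
  refine ⟨{ 𝒜 with
    φ := NatIso.ofComponents (fun V => i V.unop) fun {V W} a => ?_
    φ_tensor := fun V W => ?_
    φ_unit := ?_ }⟩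
  · change 𝒜.rightMap a.unop ≫ (i W.unop).hom = (i V.unop).hom ≫ 𝒜.leftMap a.unop
    refine hom_ext_leftEval 𝒜 fun ξ x => ?_
    rw [lin_comp, lin_comp, hi, ← form_whiskerLeft, 𝒜.rightMap_comp_rightEval,
      form_whiskerRight, ← form_whiskerRight (𝒜.leftMap a.unop), 𝒜.leftMap_comp_leftEval,
      form_whiskerLeft, hi]
  · change (i (V ⊗ W)).hom ≫ _ = _ ≫ ((i W).hom ⊗ₘ (i V).hom)
    -- On pure tensors both nested evaluations are products of two scalars, which commute.
    have key : ∀ (ζ : 𝒜.rightObj W ⊗[k] 𝒜.rightObj V) (z : V ⊗[k] W),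
        form ((α_ _ _ _).hom ≫ 𝒜.leftObj W ◁ ((α_ _ _ _).inv ≫ 𝒜.leftEval V ▷ W ≫ (λ_ W).hom) ≫
          𝒜.leftEval W) (TensorProduct.map (lin (i W).hom) (lin (i V).hom) ζ) z =
        form ((α_ _ _ _).hom ≫ V ◁ ((α_ _ _ _).inv ≫ 𝒜.rightEval W ▷ _ ≫ (λ_ _).hom) ≫
          𝒜.rightEval V) z ζ := by
      intro ζ z
      induction ζ with
      | zero => rw [map_zero]; exact (LinearMap.map_zero₂ _ _).trans (map_zero _).symm
      | add s t hs ht =>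
        rw [map_add]
        exact (LinearMap.map_add₂ _ _ _ _).trans ((congrArg₂ _ hs ht).trans (map_add _ _ _).symm)
      | tmul η ξ =>
        induction z with
        | zero => exact (map_zero _).trans (LinearMap.map_zero₂ _ _).symm
        | add s t hs ht =>
          exact (map_add _ _ _).trans
            ((congrArg₂ _ hs ht).trans (LinearMap.map_add₂ _ _ _ _).symm)
        | tmul x y =>
          rw [TensorProduct.map_tmul]
          refine (form_nested _ _ _ _ _ _).trans (Eq.trans ?_ (form_nested _ _ _ _ _ _).symm)
          rw [hi, hi, mul_comm]
    rw [← Iso.eq_comp_inv, Category.assoc]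
    refine hom_ext_leftEval 𝒜 fun ζ z => ?_
    rw [hi, ← 𝒜.leftTensorIso_comp_eval, ← 𝒜.rightTensorIso_comp_eval, form_whiskerRight,
      form_whiskerLeft, ← lin_comp, Category.assoc, Category.assoc, Iso.inv_hom_id,
      Category.comp_id, lin_comp]
    exact (key _ z).symm
  · change (i (𝟙_ _)).hom ≫ _ = _
    rw [← Iso.eq_comp_inv]
    refine hom_ext_leftEval 𝒜 fun ξ x => ?_
    rw [hi, ← 𝒜.leftUnitIso_comp_eval, ← 𝒜.rightUnitIso_comp_eval, form_whiskerRight,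
      form_whiskerLeft, ← lin_comp, Category.assoc, Iso.inv_hom_id, Category.comp_id,
      form_rightUnitor_comm]

end FGModuleCat

/-! ### Comatrices -/

section Comatrices

open Coalgebra HopfAlgebra
open scoped Matrix

variable {k : Type u} [Field k] {A : Type w} [Ring A]
variable {n : Type*} [Fintype n] [DecidableEq n]

/-- A square matrix `M` over a coalgebra with `Δ M i j = ∑ l, M i l ⊗ M l j` and `ε M = 1`. -/
structure IsComatrix (k : Type u) [Field k] [Bialgebra k A] (M : Matrix n n A) : Prop where
  comul : ∀ i j, comul (R := k) (M i j) = ∑ l, M i l ⊗ₜ[k] M l j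
  counit : ∀ i j, counit (R := k) (M i j) = (1 : Matrix n n k) i j

/-- Ring homomorphisms preserve inverse matrices, and inverting a product reverses its factors. With
`d` the comultiplication and `l`, `r` the two inclusions of `A` in `A ⊗ A`, the hypothesis is the
comatrix condition; the conclusion is that condition for `Kᵀ`. -/
lemma map_eq_mul_of_isInverse {R S : Type*} [Ring R] [Ring S] {M K : Matrix n n R}
    (hKM : K * M = 1) (hMK : M * K = 1) (d l r : R →+* S)
    (h : M.map d = M.map l * M.map r) : K.map d = K.map r * K.map l := by
  have e : ∀ (f : R →+* S) {P Q : Matrix n n R}, P * Q = 1 → P.map f * Q.map f = 1 := by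
    intro f P Q hPQ
    rw [← Matrix.map_mul, hPQ, Matrix.map_one f f.map_zero f.map_one]
  refine left_inv_eq_right_inv (a := M.map d) (e d hKM) ?_
  rw [h, Matrix.mul_assoc, ← Matrix.mul_assoc (M.map r), e r hMK, Matrix.one_mul, e l hMK]

namespace IsComatrix

/-- Since `Δ M i j = ∑ M i l ⊗ M l j`, convolution of maps becomes multiplication of matrices. -/
lemma convMul_apply [Bialgebra k A] {M : Matrix n n A} (hM : IsComatrix k M)
    {B : Type*} [Ring B] [Algebra k B]
    (f g : WithConv (A →ₗ[k] B)) : M.map (f * g) = M.map f * M.map g := by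
  ext i j
  simp [LinearMap.convMul_apply, hM.comul, Matrix.mul_apply]

variable [HopfAlgebra k A] {M : Matrix n n A}

lemma mul_map_antipode (hM : IsComatrix k M) : M * M.map (antipode k) = 1 := by
  ext i j
  have h := mul_antipode_lTensor_comul_apply (R := k) (M i j)
  rw [hM.comul, hM.counit] at h
  simp only [map_sum, LinearMap.lTensor_tmul, LinearMap.mul'_apply] at h
  rw [Matrix.mul_apply]
  simp only [Matrix.map_apply]
  rw [h, Matrix.one_apply, Matrix.one_apply]
  split_ifs <;> simp

lemma map_antipode_mul (hM : IsComatrix k M) : M.map (antipode k) * M = 1 := by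
  ext i j
  have h := mul_antipode_rTensor_comul_apply (R := k) (M i j)
  rw [hM.comul, hM.counit] at h
  simp only [map_sum, LinearMap.rTensor_tmul, LinearMap.mul'_apply] at h
  rw [Matrix.mul_apply]
  simp only [Matrix.map_apply]
  rw [h, Matrix.one_apply, Matrix.one_apply]
  split_ifs <;> simp

/-- `S(M)` is the inverse of `M`; inversion reverses the order in the comultiplication and
transposition restores it. -/
lemma transpose_map_antipode (hM : IsComatrix k M) : IsComatrix k (M.map (antipode k))ᵀ where
  comul i j := by
    have h := map_eq_mul_of_isInverse hM.map_antipode_mul hM.mul_map_antipode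
      (Bialgebra.comulAlgHom k A : A →+* A ⊗[k] A)
      (Algebra.TensorProduct.includeLeft (R := k) (S := k) (A := A) (B := A) : A →+* A ⊗[k] A)
      (Algebra.TensorProduct.includeRight (R := k) (A := A) (B := A) : A →+* A ⊗[k] A)
      (by ext i j; simp [Matrix.mul_apply, hM.comul])
    have h' := congrFun (congrFun h j) i
    simpa [Matrix.mul_apply] using h'
  counit i j := by
    simp [hM.counit, Matrix.one_apply, eq_comm]

/-- The antipode reverses products, so it carries these identities to the transposes of `M S(M) = 1`
and `S(M) M = 1`; injectivity pulls them back. -/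
lemma transpose_mul_transpose_of_map_antipode_eq (hM : IsComatrix k M)
    (hS : Function.Injective (antipode k (A := A))) {K : Matrix n n A}
    (hK : K.map (antipode k) = M) : Mᵀ * Kᵀ = 1 ∧ Kᵀ * Mᵀ = 1 := by
  have hS1 : ∀ i j, antipode k ((1 : Matrix n n A) i j) = (1 : Matrix n n A) j i := by
    intro i j
    simp only [Matrix.one_apply, eq_comm (a := i)]
    split_ifs <;> simp
  have hK' : ∀ i j, antipode k (K i j) = M i j := fun i j => by rw [← hK]; rfl
  constructor
  · ext i j
    apply hS
    rw [hS1, ← hM.mul_map_antipode]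
    simp [Matrix.mul_apply, antipode_mul_antidistrib, hK']
  · ext i j
    apply hS
    rw [hS1, ← hM.map_antipode_mul]
    simp [Matrix.mul_apply, antipode_mul_antidistrib, hK']

/-- If `S` is injective, the transpose of a matrix `K` with `S K = M` is a comatrix. -/
lemma transpose_of_map_antipode_eq (hM : IsComatrix k M)
    (hS : Function.Injective (antipode k (A := A))) {K : Matrix n n A}
    (hK : K.map (antipode k) = M) : IsComatrix k Kᵀ where
  comul i j := by
    obtain ⟨h₁, h₂⟩ := hM.transpose_mul_transpose_of_map_antipode_eq hS hK
    -- Inverses of transposes over `A` are inverses over `Aᵐᵒᵖ`. There `K` is inverse to `M`, and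
    -- the inversion argument used for `S(M)` applies again.
    have op_mul : ∀ {P Q : Matrix n n A}, Qᵀ * Pᵀ = 1 →
        P.map MulOpposite.op * Q.map MulOpposite.op = 1 := by
      intro P Q h
      ext i j
      have h' := congrFun (congrFun h j) i
      simp only [Matrix.mul_apply, Matrix.map_apply, Matrix.transpose_apply,
        ← MulOpposite.op_mul, ← Finset.op_sum] at h' ⊢
      rw [h', Matrix.one_apply, Matrix.one_apply]
      simp only [eq_comm (a := j)]
      split_ifs <;> simp
    have h := map_eq_mul_of_isInverse (op_mul h₁) (op_mul h₂)
      (RingHom.op (Bialgebra.comulAlgHom k A : A →+* A ⊗[k] A))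
      (RingHom.op (Algebra.TensorProduct.includeLeft (R := k) (S := k) (A := A) (B := A) :
        A →+* A ⊗[k] A))
      (RingHom.op (Algebra.TensorProduct.includeRight (R := k) (A := A) (B := A) :
        A →+* A ⊗[k] A))
      (by
        ext i j
        simp [Matrix.mul_apply, hM.comul, ← MulOpposite.op_mul, ← Finset.op_sum])
    have h' := congrFun (congrFun h j) i
    simpa [Matrix.mul_apply, ← MulOpposite.op_mul, ← Finset.op_sum] using h'
  counit i j := by
    rw [Matrix.transpose_apply, ← HopfAlgebra.counit_antipode,
      show antipode k (K j i) = M j i by rw [← hK]; rfl, hM.counit]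
    simp [Matrix.one_apply, eq_comm]

end IsComatrix

end Comatrices

/-! ### Coactions in terms of matrices -/

section CoactionMatrices

variable {k : Type u} [Field k] {A : Type w} [Ring A]
variable {n : Type*} [Fintype n]
variable {V : Type v} [AddCommGroup V] [Module k V]

lemma sum_basis_tmul [Algebra k A] (b : Module.Basis n k V) (t : V ⊗[k] A) :
    ∑ i, b i ⊗ₜ[k] TensorProduct.lid k A ((b.coord i).rTensor A t) = t := by
  induction t with
  | zero => simp
  | add x y hx hy => simp only [map_add, TensorProduct.tmul_add, Finset.sum_add_distrib, hx, hy]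
  | tmul v a =>
    simp only [LinearMap.rTensor_tmul, TensorProduct.lid_tmul, ← TensorProduct.smul_tmul,
      ← TensorProduct.sum_tmul]
    simp only [Module.Basis.coord_apply, b.sum_repr]

lemma sum_basis_tmul_injective {B : Type*} [AddCommGroup B] [Module k B]
    (b : Module.Basis n k V) {f g : n → B}
    (h : ∑ i, b i ⊗ₜ[k] f i = ∑ i, b i ⊗ₜ[k] g i) : f = g := by
  classical
  ext j
  have h' := congrArg (fun t => TensorProduct.lid k B ((b.coord j).rTensor B t)) h
  simpa [Finsupp.single_apply, ite_smul] using h'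

/-- The matrix of a coaction in a basis. -/
def coactionMatrix [Algebra k A] (b : Module.Basis n k V) (ρ : V →ₗ[k] V ⊗[k] A) :
    Matrix n n A :=
  fun i j => TensorProduct.lid k A ((b.coord i).rTensor A (ρ (b j)))

lemma coaction_basis [Algebra k A] (b : Module.Basis n k V) (ρ : V →ₗ[k] V ⊗[k] A) (j : n) :
    ρ (b j) = ∑ i, b i ⊗ₜ[k] coactionMatrix b ρ i j :=
  (sum_basis_tmul b _).symm

lemma coactionMatrix_eq [Algebra k A] (b : Module.Basis n k V) {ρ : V →ₗ[k] V ⊗[k] A}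
    {M : Matrix n n A} (h : ∀ j, ρ (b j) = ∑ i, b i ⊗ₜ[k] M i j) : coactionMatrix b ρ = M := by
  ext i j
  exact congrFun (sum_basis_tmul_injective b ((coaction_basis b ρ j).symm.trans (h j))) i

variable [Bialgebra k A]

/-- Both axioms can be tested on `b`, and coefficients with respect to `b` are unique. -/
lemma isCoaction_iff_isComatrix [DecidableEq n] (b : Module.Basis n k V) (ρ : V →ₗ[k] V ⊗[k] A) :
    IsCoaction ρ ↔ IsComatrix k (coactionMatrix b ρ) := by
  set M := coactionMatrix b ρ with hM
  have h : ∀ j, ρ (b j) = ∑ i, b i ⊗ₜ[k] M i j := coaction_basis b ρ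
  have h₁ : ∀ j, ((TensorProduct.assoc k V A A).toLinearMap ∘ₗ ρ.rTensor A ∘ₗ ρ) (b j) =
      ∑ i, b i ⊗ₜ[k] ∑ l, M i l ⊗ₜ[k] M l j := by
    intro j
    simp only [LinearMap.comp_apply, h, map_sum, LinearMap.rTensor_tmul, TensorProduct.sum_tmul,
      LinearEquiv.coe_coe, TensorProduct.assoc_tmul, TensorProduct.tmul_sum]
    exact Finset.sum_comm
  have h₂ : ∀ j, ((Coalgebra.comul (R := k) (A := A)).lTensor V ∘ₗ ρ) (b j) =
      ∑ i, b i ⊗ₜ[k] Coalgebra.comul (R := k) (M i j) := by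
    intro j
    simp only [LinearMap.comp_apply, h, map_sum, LinearMap.lTensor_tmul]
  have h₃ : ∀ j, ((TensorProduct.rid k V).toLinearMap ∘ₗ
      (Coalgebra.counit (R := k) (A := A)).lTensor V ∘ₗ ρ) (b j) =
      ∑ i, Coalgebra.counit (R := k) (M i j) • b i := by
    intro j
    simp only [LinearMap.comp_apply, h, map_sum, LinearMap.lTensor_tmul,
      LinearEquiv.coe_coe, TensorProduct.rid_tmul]
  constructor
  · rintro ⟨hc, he⟩
    constructor
    · intro i j
      have := (h₁ j).symm.trans ((LinearMap.congr_fun hc (b j)).trans (h₂ j))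
      exact (congrFun (sum_basis_tmul_injective b this) i).symm
    · intro i j
      have := (h₃ j).symm.trans (LinearMap.congr_fun he (b j))
      have h' := congrArg (b.coord i) this
      simpa [Finsupp.single_apply, Matrix.one_apply, eq_comm] using h'
  · rintro ⟨hc, he⟩
    constructor
    · refine b.ext fun j => ?_
      rw [h₁, h₂]
      simp only [hc]
    · refine b.ext fun j => ?_
      rw [h₃]
      simp [he, Matrix.one_apply]

lemma tensorCoaction_basis {V' : Type v} [AddCommGroup V'] [Module k V'] {m : Type*} [Fintype m]
    (b : Module.Basis n k V) (c : Module.Basis m k V') (ρ : V →ₗ[k] V ⊗[k] A)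
    (σ : V' →ₗ[k] V' ⊗[k] A) (i : n) (j : m) :
    tensorCoaction ρ σ (b i ⊗ₜ[k] c j) =
      ∑ p, ∑ q, (b p ⊗ₜ[k] c q) ⊗ₜ[k] (coactionMatrix b ρ p i * coactionMatrix c σ q j) := by
  simp only [tensorCoaction, LinearMap.comp_apply, TensorProduct.map_tmul, coaction_basis,
    TensorProduct.sum_tmul, TensorProduct.tmul_sum, map_sum, LinearEquiv.coe_coe,
    TensorProduct.tensorTensorTensorComm_tmul, LinearMap.lTensor_tmul, LinearMap.mul'_apply]
  rw [Finset.sum_comm]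

/-- A bilinear form on comodules with Gram matrix `E` is invariant if and only if
`Mᵀ * E * N = E`, where `M` and `N` are the matrices of the comodules. -/
lemma form_colinear_iff {U U' : Type u} [AddCommGroup U] [Module k U] [AddCommGroup U'] [Module k U']
    (b : Module.Basis n k U) (c : Module.Basis n k U')
    (ρ : U →ₗ[k] U ⊗[k] A) (σ : U' →ₗ[k] U' ⊗[k] A) (e : U ⊗[k] U' →ₗ[k] k) :
    unitCoaction k A ∘ₗ e = e.rTensor A ∘ₗ tensorCoaction ρ σ ↔
      (coactionMatrix b ρ).transpose *
        (Matrix.of fun i j => algebraMap k A (e (b i ⊗ₜ[k] c j))) * coactionMatrix c σ =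
        Matrix.of fun i j => algebraMap k A (e (b i ⊗ₜ[k] c j)) := by
  have key : ∀ i j, TensorProduct.lid k A ((e.rTensor A ∘ₗ tensorCoaction ρ σ) (b i ⊗ₜ[k] c j)) =
      ((coactionMatrix b ρ).transpose *
        (Matrix.of fun i j => algebraMap k A (e (b i ⊗ₜ[k] c j))) * coactionMatrix c σ) i j := by
    intro i j
    simp only [LinearMap.comp_apply, tensorCoaction_basis, map_sum, LinearMap.rTensor_tmul,
      TensorProduct.lid_tmul, Matrix.mul_apply, Matrix.transpose_apply, Matrix.of_apply,
      Finset.sum_mul]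
    rw [Finset.sum_comm]
    refine Finset.sum_congr rfl fun q _ => Finset.sum_congr rfl fun p _ => ?_
    -- Gram entries are scalars, hence central, and may be moved between the entries of `M` and `N`.
    rw [Algebra.smul_def, ← mul_assoc, Algebra.commutes]
  have key' : ∀ i j, TensorProduct.lid k A ((unitCoaction k A ∘ₗ e) (b i ⊗ₜ[k] c j)) =
      algebraMap k A (e (b i ⊗ₜ[k] c j)) := by
    intro i j
    simp [unitCoaction, Algebra.algebraMap_eq_smul_one]
  constructor
  · intro h
    ext i j
    rw [← key, ← h, key']
    rfl
  · intro h
    refine (b.tensorProduct c).ext fun ⟨i, j⟩ => ?_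
    apply (TensorProduct.lid k A).injective
    rw [Module.Basis.tensorProduct_apply, key, key', h]
    rfl

end CoactionMatrices

/-! ### Duals of comodules -/

namespace FinComod

open HopfAlgebra
open scoped Matrix

variable {k : Type u} [Field k] {A : Type w} [Ring A]

section

variable [Bialgebra k A]

/-- Every comatrix is the matrix of a comodule. -/
lemma exists_coactionMatrix_eq {n : ℕ} {M : Matrix (Fin n) (Fin n) A} (hM : IsComatrix k M) :
    ∃ (Y : FinComod k A) (c : Module.Basis (Fin n) k Y.carrier),
      coactionMatrix c Y.coact = M := by
  let ρ : (Fin n → k) →ₗ[k] (Fin n → k) ⊗[k] A :=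
    (Pi.basisFun k (Fin n)).constr k fun j => ∑ i, Pi.basisFun k (Fin n) i ⊗ₜ[k] M i j
  have h : coactionMatrix (Pi.basisFun k (Fin n)) ρ = M :=
    coactionMatrix_eq _ fun _ => Module.Basis.constr_basis _ _ _ _
  exact ⟨⟨Fin n → k, ρ, (isCoaction_iff_isComatrix _ _).2 (h.symm ▸ hM)⟩, _, h⟩

lemma isComatrix_coactionMatrix {n : Type*} [Fintype n] [DecidableEq n] (X : FinComod k A)
    (b : Module.Basis n k X.carrier) : IsComatrix k (coactionMatrix b X.coact) :=
  (isCoaction_iff_isComatrix b X.coact).1 X.isCoaction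

/-- Comodules whose matrices are contragredient are dual to each other. -/
lemma nonempty_exactPairing {n : Type*} [Fintype n] [DecidableEq n] (X Y : FinComod k A)
    (b : Module.Basis n k X.carrier) (c : Module.Basis n k Y.carrier)
    (h₁ : (coactionMatrix c Y.coact)ᵀ * coactionMatrix b X.coact = 1)
    (h₂ : coactionMatrix b X.coact * (coactionMatrix c Y.coact)ᵀ = 1) :
    Nonempty (ExactPairing X Y) := by
  -- The pairing that makes `c` the basis dual to `b`. Its Gram matrix is `1`, so its invariance is
  -- `h₁`; that of the coevaluation `∑ b i ⊗ c i` is `h₂`.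
  let ev : Y.carrier ⊗[k] X.carrier →ₗ[k] k :=
    (c.tensorProduct b).constr k fun p => (1 : Matrix n n k) p.1 p.2
  have hev : ∀ i j, ev (c i ⊗ₜ[k] b j) = (1 : Matrix n n k) i j := by
    intro i j
    rw [← Module.Basis.tensorProduct_apply, Module.Basis.constr_basis]
  let cv : k →ₗ[k] X.carrier ⊗[k] Y.carrier :=
    LinearMap.toSpanSingleton k _ (∑ i, b i ⊗ₜ[k] c i)
  have hcv : cv 1 = ∑ i, b i ⊗ₜ[k] c i := one_smul k _
  have ev_comm : unitCoaction k A ∘ₗ ev = ev.rTensor A ∘ₗ tensorCoaction Y.coact X.coact := by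
    rw [form_colinear_iff c b]
    have h1 : (Matrix.of fun i j => algebraMap k A (ev (c i ⊗ₜ[k] b j))) = 1 := by
      ext i j
      rw [Matrix.of_apply, hev, Matrix.one_apply, Matrix.one_apply]
      split_ifs <;> simp
    rw [h1, Matrix.mul_one, h₁]
  have cv_comm : tensorCoaction X.coact Y.coact ∘ₗ cv = cv.rTensor A ∘ₗ unitCoaction k A := by
    refine LinearMap.ext_ring ?_
    simp only [LinearMap.comp_apply, hcv, map_sum, tensorCoaction_basis, unitCoaction,
      LinearMap.flip_apply, TensorProduct.mk_apply, LinearMap.rTensor_tmul]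
    have h : ∀ p q, ∑ i, coactionMatrix b X.coact p i * coactionMatrix c Y.coact q i =
        (1 : Matrix n n A) p q := by
      intro p q
      rw [← h₂, Matrix.mul_apply]
      rfl
    have h' : ∀ p, ∑ i, ∑ q, (b p ⊗ₜ[k] c q) ⊗ₜ[k]
        (coactionMatrix b X.coact p i * coactionMatrix c Y.coact q i) =
        (b p ⊗ₜ[k] c p) ⊗ₜ[k] (1 : A) := by
      intro p
      rw [Finset.sum_comm]
      simp only [← TensorProduct.tmul_sum, h, Matrix.one_apply, TensorProduct.tmul_ite,
        Finset.sum_ite_eq, Finset.mem_univ, if_true]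
    rw [Finset.sum_comm, TensorProduct.sum_tmul]
    exact Finset.sum_congr rfl fun p _ => h' p
  let ε : Y ⊗ X ⟶ 𝟙_ (FinComod k A) := ⟨ev, ev_comm⟩
  let η : 𝟙_ (FinComod k A) ⟶ X ⊗ Y := ⟨cv, cv_comm⟩
  refine ⟨⟨η, ε, ?_, ?_⟩⟩
  · apply hom_ext
    change TensorProduct.map ev LinearMap.id ∘ₗ
      (TensorProduct.assoc k Y.carrier X.carrier Y.carrier).symm.toLinearMap ∘ₗ
      TensorProduct.map LinearMap.id cv =
      (TensorProduct.lid k Y.carrier).symm.toLinearMap ∘ₗ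
        (TensorProduct.rid k Y.carrier).toLinearMap
    refine TensorProduct.ext (c.ext fun i => LinearMap.ext_ring ?_)
    simp [hcv, TensorProduct.tmul_sum, hev, Matrix.one_apply, TensorProduct.ite_tmul]
  · apply hom_ext
    change TensorProduct.map LinearMap.id ev ∘ₗ
      (TensorProduct.assoc k X.carrier Y.carrier X.carrier).toLinearMap ∘ₗ
      TensorProduct.map cv LinearMap.id =
      (TensorProduct.rid k X.carrier).symm.toLinearMap ∘ₗ
        (TensorProduct.lid k X.carrier).toLinearMap
    refine TensorProduct.ext (LinearMap.ext_ring (b.ext fun i => ?_))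
    simp [hcv, TensorProduct.sum_tmul, hev, Matrix.one_apply, TensorProduct.tmul_ite]

end

variable [HopfAlgebra k A]

/-- If the antipode is bijective, every finite-dimensional comodule has a left and a right dual. -/
lemma isAutonomous_of_bijective_antipode (hS : Function.Bijective (antipode k (A := A))) :
    IsAutonomous (FinComod k A) := by
  intro X
  let b := Module.finBasis k X.carrier
  have hM := X.isComatrix_coactionMatrix b
  set M := coactionMatrix b X.coact
  constructor
  -- The left dual is the contragredient comodule, with matrix `S(M)ᵀ`.
  · obtain ⟨Y, c, e⟩ := exists_coactionMatrix_eq hM.transpose_map_antipode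
    obtain ⟨p⟩ := nonempty_exactPairing X Y b c
      (by rw [e]; exact hM.map_antipode_mul) (by rw [e]; exact hM.mul_map_antipode)
    exact ⟨⟨Y⟩⟩
  -- The right dual is the contragredient for the inverse antipode, with matrix `S⁻¹(M)ᵀ`.
  · let K : Matrix _ _ A := M.map (LinearEquiv.ofBijective (antipode k (A := A)) hS).symm
    have hK : K.map (antipode k) = M := by
      ext i j
      exact (LinearEquiv.ofBijective (antipode k (A := A)) hS).apply_symm_apply _
    obtain ⟨h₁, h₂⟩ := hM.transpose_mul_transpose_of_map_antipode_eq hS.1 hK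
    obtain ⟨Y, c, e⟩ := exists_coactionMatrix_eq (hM.transpose_of_map_antipode_eq hS.1 hK)
    obtain ⟨p⟩ := nonempty_exactPairing Y X c b (by rw [e]; exact h₁) (by rw [e]; exact h₂)
    exact ⟨⟨Y⟩⟩

end FinComod

/-! ### Reconstruction of characters -/

namespace FinComod

open Coalgebra

variable {k : Type u} [Field k] {A : Type w} [Ring A] [Bialgebra k A]

/-- A linear map `g : X → A` is colinear for the right coaction `Δ` on `A`. -/
def IsColinear (X : FinComod k A) (g : X.carrier →ₗ[k] A) : Prop :=
  comul (R := k) ∘ₗ g = g.rTensor A ∘ₗ X.coact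

/-- A subspace `V` of `A` with `Δ V ⊆ V ⊗ A`. -/
def IsSubcomodule (V : Submodule k A) : Prop :=
  ∀ a ∈ V, comul (R := k) a ∈ LinearMap.range (V.subtype.rTensor A)

lemma range_rTensor_mono {V W : Submodule k A} (h : V ≤ W) :
    LinearMap.range (V.subtype.rTensor A) ≤ LinearMap.range (W.subtype.rTensor A) := by
  rw [← Submodule.subtype_comp_inclusion V W h, LinearMap.rTensor_comp]
  exact LinearMap.range_comp_le_range _ _

lemma IsSubcomodule.sup {V W : Submodule k A} (hV : IsSubcomodule V) (hW : IsSubcomodule W) :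
    IsSubcomodule (V ⊔ W) := by
  intro a ha
  obtain ⟨v, hv, w, hw, rfl⟩ := Submodule.mem_sup.1 ha
  rw [map_add]
  exact add_mem (range_rTensor_mono le_sup_left (hV v hv))
    (range_rTensor_mono le_sup_right (hW w hw))

lemma IsColinear.isSubcomodule_range {X : FinComod k A} {g : X.carrier →ₗ[k] A}
    (hg : X.IsColinear g) : IsSubcomodule (LinearMap.range g) := by
  rintro _ ⟨x, rfl⟩
  refine ⟨g.rangeRestrict.rTensor A (X.coact x), ?_⟩
  rw [← LinearMap.comp_apply, ← LinearMap.rTensor_comp]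
  exact (LinearMap.congr_fun hg x).symm

/-- Expand `t` along a basis of the second factor: coordinate functionals extract the first legs,
which therefore lie in `V`. -/
lemma mem_range_rTensor_of_forall {V : Submodule k A} {t : A ⊗[k] A}
    (h : ∀ f : A →ₗ[k] k, TensorProduct.rid k A (f.lTensor A t) ∈ V) :
    t ∈ LinearMap.range (V.subtype.rTensor A) := by
  classical
  let B := Module.Basis.ofVectorSpace k A
  obtain ⟨c, rfl⟩ := TensorProduct.eq_repr_basis_right B t
  have hc : ∀ i, c i ∈ V := by
    intro i
    have := h (B.coord i)
    by_cases h0 : c i = 0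
    · rw [h0]
      exact V.zero_mem
    · simpa [Finsupp.sum, Finsupp.single_apply, ite_smul, h0] using this
  refine Submodule.sum_mem _ fun i _ => ⟨(⟨c i, hc i⟩ : V) ⊗ₜ[k] B i, ?_⟩
  simp

/-- Every element of `A` lies in a finite-dimensional subcomodule. -/
lemma exists_subcomodule (a : A) :
    ∃ V : Submodule k A, Module.Finite k V ∧ IsSubcomodule V ∧ a ∈ V := by
  -- The subcomodule consists of all `f(a₂) a₁`. It lies in the span of the finitely many left legs
  -- of `Δ a`, and `f = ε` gives `a` itself.
  let L : (A →ₗ[k] k) →ₗ[k] A :=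
    (TensorProduct.rid k A).toLinearMap ∘ₗ
      (LinearMap.applyₗ (comul (R := k) a)) ∘ₗ LinearMap.lTensorHom A
  have hL : ∀ f, L f = TensorProduct.rid k A (f.lTensor A (comul (R := k) a)) := fun _ => rfl
  refine ⟨LinearMap.range L, ?_, ?_, ⟨counit, ?_⟩⟩
  · let r := Repr.arbitrary k a
    have hle : LinearMap.range L ≤ Submodule.span k (r.left '' r.index) := by
      rintro _ ⟨f, rfl⟩
      rw [hL, ← r.eq]
      simp only [map_sum, LinearMap.lTensor_tmul, TensorProduct.rid_tmul]
      exact Submodule.sum_mem _ fun i hi =>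
        Submodule.smul_mem _ _ (Submodule.subset_span ⟨i, hi, rfl⟩)
    have : Module.Finite k (Submodule.span k (r.left '' r.index)) :=
      FiniteDimensional.span_of_finite k (r.index.finite_toSet.image _)
    exact Submodule.finiteDimensional_of_le hle
  · rintro _ ⟨f, rfl⟩
    refine mem_range_rTensor_of_forall fun g => ?_
    -- By coassociativity, contracting `Δ (f(a₂) a₁)` with `g` gives `g(a₂) f(a₃) a₁`, so the
    -- functional is the convolution `g * f`.
    refine ⟨LinearMap.mul' k k ∘ₗ TensorProduct.map g f ∘ₗ comul, ?_⟩
    have key : ∀ t : A ⊗[k] A,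
        TensorProduct.rid k A (g.lTensor A (comul (R := k)
          (TensorProduct.rid k A (f.lTensor A t)))) =
        TensorProduct.rid k A ((LinearMap.mul' k k ∘ₗ TensorProduct.map g f).lTensor A
          (TensorProduct.assoc k A A A ((comul (R := k)).rTensor A t))) := by
      intro t
      induction t with
      | zero => simp
      | add x y hx hy => simp only [map_add, hx, hy]
      | tmul x y =>
        simp only [LinearMap.lTensor_tmul, TensorProduct.rid_tmul, map_smul,
          LinearMap.rTensor_tmul]
        generalize comul (R := k) x = s
        induction s with
        | zero => simp
        | add s₁ s₂ h₁ h₂ => simp only [TensorProduct.add_tmul, map_add, smul_add, h₁, h₂]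
        | tmul p q => simp [smul_smul, mul_comm]
    rw [hL, hL, key, coassoc_apply, ← LinearMap.comp_assoc, LinearMap.lTensor_comp,
      LinearMap.comp_apply]
  · rw [hL]
    simp

lemma exists_comp_eq_of_injective {U V W : Type*} [AddCommGroup U] [Module k U] [AddCommGroup V]
    [Module k V] [AddCommGroup W] [Module k W] {j : U →ₗ[k] W} (hj : Function.Injective j)
    {g : V →ₗ[k] W} (hg : ∀ x, g x ∈ LinearMap.range j) : ∃ f : V →ₗ[k] U, j ∘ₗ f = g :=
  ⟨(LinearEquiv.ofInjective j hj).symm.toLinearMap ∘ₗ g.codRestrict _ hg, LinearMap.ext fun x =>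
    congrArg Subtype.val
      ((LinearEquiv.ofInjective j hj).apply_symm_apply (g.codRestrict _ hg x))⟩

/-- Tensoring over a field keeps `j` injective, so the axioms may be checked inside `A`, where they
are those of its coalgebra structure. -/
lemma isCoaction_of_injective {V : Type v} [AddCommGroup V] [Module k V] {j : V →ₗ[k] A}
    (hj : Function.Injective j) {ρ : V →ₗ[k] V ⊗[k] A}
    (hρ : j.rTensor A ∘ₗ ρ = comul (R := k) ∘ₗ j) : IsCoaction ρ where
  coassoc := by
    have hJ : Function.Injective (j.rTensor (A ⊗[k] A)) :=
      Module.Flat.rTensor_preserves_injective_linearMap j hj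
    have h₁ : j.rTensor (A ⊗[k] A) ∘ₗ (TensorProduct.assoc k V A A).toLinearMap =
        (TensorProduct.assoc k A A A).toLinearMap ∘ₗ (j.rTensor A).rTensor A :=
      TensorProduct.ext_threefold fun _ _ _ => by simp
    have h₂ : j.rTensor (A ⊗[k] A) ∘ₗ (comul (R := k)).lTensor V =
        (comul (R := k)).lTensor A ∘ₗ j.rTensor A :=
      TensorProduct.ext' fun _ _ => by simp
    rw [← LinearMap.cancel_left hJ]
    calc j.rTensor (A ⊗[k] A) ∘ₗ (TensorProduct.assoc k V A A).toLinearMap ∘ₗ ρ.rTensor A ∘ₗ ρ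
        = (TensorProduct.assoc k A A A).toLinearMap ∘ₗ (j.rTensor A ∘ₗ ρ).rTensor A ∘ₗ ρ := by
          rw [← LinearMap.comp_assoc, h₁, LinearMap.rTensor_comp]
          simp only [LinearMap.comp_assoc]
      _ = ((TensorProduct.assoc k A A A).toLinearMap ∘ₗ (comul (R := k)).rTensor A ∘ₗ
            comul) ∘ₗ j := by
          rw [hρ, LinearMap.rTensor_comp, LinearMap.comp_assoc, hρ]
          simp only [LinearMap.comp_assoc]
      _ = j.rTensor (A ⊗[k] A) ∘ₗ (comul (R := k)).lTensor V ∘ₗ ρ := by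
          rw [coassoc, ← LinearMap.comp_assoc ρ, h₂, LinearMap.comp_assoc, LinearMap.comp_assoc,
            hρ]
  counit := by
    have h₁ : j ∘ₗ (TensorProduct.rid k V).toLinearMap ∘ₗ (counit (R := k)).lTensor V =
        (TensorProduct.rid k A).toLinearMap ∘ₗ (counit (R := k)).lTensor A ∘ₗ j.rTensor A :=
      TensorProduct.ext' fun _ _ => by simp
    rw [← LinearMap.cancel_left hj, ← LinearMap.comp_assoc ρ, ← LinearMap.comp_assoc ρ, h₁,
      LinearMap.comp_assoc, LinearMap.comp_assoc, hρ]
    ext x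
    simp

/-- A finite-dimensional subcomodule of `A` is the image of a colinear embedding. -/
lemma IsSubcomodule.exists_embedding {V : Submodule k A} [Module.Finite k V]
    (hV : IsSubcomodule V) :
    ∃ (U : FinComod k A) (j : U.carrier →ₗ[k] A),
      Function.Injective j ∧ LinearMap.range j = V ∧ U.IsColinear j := by
  -- `A` lives in a universe other than that of the comodule carriers, so `V` is replaced by a
  -- coordinate space over `k`.
  let e := (Module.finBasis k V).equivFun
  obtain ⟨j, hj⟩ : ∃ j, j = V.subtype ∘ₗ e.symm.toLinearMap := ⟨_, rfl⟩
  have hji : Function.Injective j := by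
    rw [hj]
    exact V.injective_subtype.comp e.symm.injective
  have hjV : LinearMap.range j = V := by
    rw [hj, LinearMap.range_comp, LinearEquiv.range, Submodule.map_top, Submodule.range_subtype]
  have hje : j ∘ₗ e.toLinearMap = V.subtype := by
    rw [hj]
    ext v
    simp
  obtain ⟨ρ, hρ⟩ := exists_comp_eq_of_injective
    (Module.Flat.rTensor_preserves_injective_linearMap (M := A) j hji)
    (g := comul (R := k) ∘ₗ j) fun x => by
      obtain ⟨t, ht⟩ := hV (j x) (hjV.le ⟨x, rfl⟩)
      refine ⟨e.toLinearMap.rTensor A t, ?_⟩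
      rw [LinearMap.comp_apply, ← ht, ← LinearMap.comp_apply, ← LinearMap.rTensor_comp, hje]
  exact ⟨⟨_, ρ, isCoaction_of_injective hji hρ⟩, j, hji, hjV, hρ.symm⟩

/-- A colinear map to `A` factors through an embedding that contains its image. -/
lemma IsColinear.exists_factor {X U : FinComod k A} {g : X.carrier →ₗ[k] A}
    {j : U.carrier →ₗ[k] A} (hg : X.IsColinear g) (hj : U.IsColinear j)
    (hji : Function.Injective j) (h : LinearMap.range g ≤ LinearMap.range j) :
    ∃ f : X ⟶ U, ∀ x, j (linMap f x) = g x := by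
  obtain ⟨f, hf⟩ := exists_comp_eq_of_injective hji fun x => h ⟨x, rfl⟩
  refine ⟨⟨f, LinearMap.ext fun x =>
    Module.Flat.rTensor_preserves_injective_linearMap (M := A) j hji ?_⟩, LinearMap.congr_fun hf⟩
  have h₁ := LinearMap.congr_fun hj (f x)
  have h₂ := LinearMap.congr_fun hg x
  rw [← hf, LinearMap.rTensor_comp] at h₂
  exact h₁.symm.trans h₂

/-- The matrix coefficient `x ↦ f(x₀) x₁` as a map `X → A`. -/
def coefficient (X : FinComod k A) (f : X.carrier →ₗ[k] k) : X.carrier →ₗ[k] A :=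
  (TensorProduct.lid k A).toLinearMap ∘ₗ f.rTensor A ∘ₗ X.coact

/-- By coassociativity, `Δ (f(x₀) x₁) = f(x₀) x₁ ⊗ x₂`. -/
lemma isColinear_coefficient (X : FinComod k A) (f : X.carrier →ₗ[k] k) :
    X.IsColinear (X.coefficient f) := by
  have h₁ : ∀ t : X.carrier ⊗[k] A, comul (R := k) (TensorProduct.lid k A (f.rTensor A t)) =
      TensorProduct.lid k (A ⊗[k] A) (f.rTensor (A ⊗[k] A) ((comul (R := k)).lTensor _ t)) :=
    fun t => LinearMap.congr_fun
      (f := comul (R := k) ∘ₗ (TensorProduct.lid k A).toLinearMap ∘ₗ f.rTensor A)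
      (g := (TensorProduct.lid k (A ⊗[k] A)).toLinearMap ∘ₗ f.rTensor (A ⊗[k] A) ∘ₗ
        (comul (R := k)).lTensor _)
      (TensorProduct.ext' fun _ _ => by simp) t
  have h₂ : ∀ t : (X.carrier ⊗[k] A) ⊗[k] A,
      TensorProduct.lid k (A ⊗[k] A) (f.rTensor (A ⊗[k] A) (TensorProduct.assoc k _ A A t)) =
      ((TensorProduct.lid k A).toLinearMap ∘ₗ f.rTensor A).rTensor A t :=
    fun t => LinearMap.congr_fun
      (f := (TensorProduct.lid k (A ⊗[k] A)).toLinearMap ∘ₗ f.rTensor (A ⊗[k] A) ∘ₗ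
        (TensorProduct.assoc k _ A A).toLinearMap)
      (g := ((TensorProduct.lid k A).toLinearMap ∘ₗ f.rTensor A).rTensor A)
      (TensorProduct.ext_threefold fun _ _ _ => by simp [TensorProduct.smul_tmul']) t
  refine LinearMap.ext fun x => ?_
  have h₃ := LinearMap.congr_fun X.isCoaction.coassoc x
  simp only [LinearMap.comp_apply, LinearEquiv.coe_coe] at h₃
  rw [coefficient, ← LinearMap.comp_assoc X.coact,
    LinearMap.rTensor_comp A ((TensorProduct.lid k A).toLinearMap ∘ₗ f.rTensor A)]
  simp only [LinearMap.comp_apply, LinearEquiv.coe_coe]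
  rw [h₁, ← h₃, h₂]

lemma counit_coefficient (X : FinComod k A) (f : X.carrier →ₗ[k] k) (x : X.carrier) :
    counit (R := k) (X.coefficient f x) = f x := by
  have h₁ : ∀ t : X.carrier ⊗[k] A, counit (R := k) (TensorProduct.lid k A (f.rTensor A t)) =
      f (TensorProduct.rid k _ ((counit (R := k)).lTensor _ t)) :=
    fun t => LinearMap.congr_fun
      (f := counit (R := k) ∘ₗ (TensorProduct.lid k A).toLinearMap ∘ₗ f.rTensor A)
      (g := f ∘ₗ (TensorProduct.rid k _).toLinearMap ∘ₗ (counit (R := k)).lTensor _)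
      (TensorProduct.ext' fun _ _ => by simp [mul_comm]) t
  have h₂ := LinearMap.congr_fun X.isCoaction.counit x
  simp only [LinearMap.comp_apply, LinearEquiv.coe_coe] at h₂
  simp only [coefficient, LinearMap.comp_apply, LinearEquiv.coe_coe]
  rw [h₁, h₂]
  rfl

/-- `Δ` is multiplicative and the diagonal coaction multiplies the `A`-legs. This is how monoidality
of `θ` becomes multiplicativity of `Φ`. -/
lemma IsColinear.mul {X Y : FinComod k A} {g : X.carrier →ₗ[k] A} {h : Y.carrier →ₗ[k] A}
    (hg : X.IsColinear g) (hh : Y.IsColinear h) :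
    (X.tensor Y).IsColinear (LinearMap.mul' k A ∘ₗ TensorProduct.map g h) := by
  refine TensorProduct.ext' fun x y => ?_
  have hx := LinearMap.congr_fun hg x
  have hy := LinearMap.congr_fun hh y
  simp only [LinearMap.comp_apply] at hx hy
  have key : ∀ (s : X.carrier ⊗[k] A) (t : Y.carrier ⊗[k] A),
      g.rTensor A s * h.rTensor A t =
      (LinearMap.mul' k A ∘ₗ TensorProduct.map g h).rTensor A
        ((LinearMap.mul' k A).lTensor (X.carrier ⊗[k] Y.carrier)
          (TensorProduct.tensorTensorTensorComm k _ A _ A (s ⊗ₜ[k] t))) := by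
    intro s t
    induction s with
    | zero => simp
    | add s₁ s₂ h₁ h₂ => simp only [TensorProduct.add_tmul, map_add, add_mul, h₁, h₂]
    | tmul v a =>
      induction t with
      | zero => simp
      | add t₁ t₂ h₁ h₂ => simp only [TensorProduct.tmul_add, map_add, mul_add, h₁, h₂]
      | tmul w b => simp
  change comul (R := k) (g x * h y) = _
  rw [Bialgebra.comul_mul, hx, hy]
  exact key _ _

/-- The action `x ↦ Φ(x₁) x₀` of a linear form on a comodule. -/
def formAction (Φ : A →ₗ[k] k) (X : FinComod k A) : X.carrier →ₗ[k] X.carrier :=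
  (TensorProduct.rid k X.carrier).toLinearMap ∘ₗ Φ.lTensor X.carrier ∘ₗ X.coact

lemma apply_formAction (Φ : A →ₗ[k] k) (X : FinComod k A) (f : X.carrier →ₗ[k] k)
    (x : X.carrier) : f (formAction Φ X x) = Φ (X.coefficient f x) := by
  simp only [formAction, coefficient, LinearMap.comp_apply, LinearEquiv.coe_coe]
  generalize X.coact x = t
  induction t with
  | zero => simp
  | add s t hs ht => simp only [map_add, hs, ht]
  | tmul v a => simp [mul_comm]

/-- A monoidal natural endomorphism of the forgetful functor is the action of a character. -/
theorem exists_character (θ : ∀ X : FinComod k A, X.carrier →ₗ[k] X.carrier)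
    (hnat : ∀ {X Y : FinComod k A} (f : X ⟶ Y) (x), θ Y (linMap f x) = linMap f (θ X x))
    (htensor : ∀ X Y : FinComod k A, θ (X.tensor Y) = TensorProduct.map (θ X) (θ Y))
    (hunit : θ (unit k A) = LinearMap.id) :
    ∃ Φ : A →ₐ[k] k, ∀ X, θ X = formAction Φ.toLinearMap X := by
  -- The value `ε (g (θ x))` depends only on the element `g x` of `A`: both maps factor through a
  -- comodule embedded in `A` that contains both images, and `θ` commutes with the factorizations.
  have key : ∀ {X Y : FinComod k A} {g : X.carrier →ₗ[k] A} {h : Y.carrier →ₗ[k] A}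
      (_ : X.IsColinear g) (_ : Y.IsColinear h) (x : X.carrier) (y : Y.carrier), g x = h y →
      counit (R := k) (g (θ X x)) = counit (R := k) (h (θ Y y)) := by
    intro X Y g h hg hh x y hxy
    obtain ⟨U, j, hji, hjr, hj⟩ := (hg.isSubcomodule_range.sup hh.isSubcomodule_range).exists_embedding
    obtain ⟨p, hp⟩ := hg.exists_factor hj hji (hjr ▸ le_sup_left)
    obtain ⟨q, hq⟩ := hh.exists_factor hj hji (hjr ▸ le_sup_right)
    rw [← hp, ← hq, ← hnat, ← hnat, hji ((hp x).trans (hxy.trans (hq y).symm))]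
  have hex : ∀ V : Submodule k A, Module.Finite k V → IsSubcomodule V →
      ∃ (U : FinComod k A) (j : U.carrier →ₗ[k] A), U.IsColinear j ∧ ∀ a ∈ V, ∃ x, j x = a := by
    intro V _ hV
    obtain ⟨U, j, -, hjr, hj⟩ := hV.exists_embedding
    exact ⟨U, j, hj, fun a ha => by rwa [← hjr] at ha⟩
  have hex₁ : ∀ a : A, ∃ (U : FinComod k A) (j : U.carrier →ₗ[k] A), U.IsColinear j ∧
      ∃ x, j x = a := by
    intro a
    obtain ⟨V, hf, hV, ha⟩ := exists_subcomodule (k := k) a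
    obtain ⟨U, j, hj, h⟩ := hex V hf hV
    exact ⟨U, j, hj, h a ha⟩
  have hex₂ : ∀ a b : A, ∃ (U : FinComod k A) (j : U.carrier →ₗ[k] A), U.IsColinear j ∧
      (∃ x, j x = a) ∧ ∃ y, j y = b := by
    intro a b
    obtain ⟨V, _, hV, ha⟩ := exists_subcomodule (k := k) a
    obtain ⟨W, _, hW, hb⟩ := exists_subcomodule (k := k) b
    obtain ⟨U, j, hj, h⟩ := hex (V ⊔ W) inferInstance (hV.sup hW)
    exact ⟨U, j, hj, h a (Submodule.mem_sup_left ha), h b (Submodule.mem_sup_right hb)⟩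
  choose U j hj x hx using hex₁
  -- Informally, `Φ` is `θ` extended to the comodule `A`, followed by the counit.
  let Φ : A → k := fun a => counit (R := k) (j a (θ (U a) (x a)))
  have hΦ : ∀ {X : FinComod k A} {g : X.carrier →ₗ[k] A} (_ : X.IsColinear g) (y : X.carrier),
      Φ (g y) = counit (R := k) (g (θ X y)) :=
    fun hg y => key (hj _) hg _ _ (hx _)
  have hadd : ∀ a b, Φ (a + b) = Φ a + Φ b := by
    intro a b
    obtain ⟨X, g, hg, ⟨x, rfl⟩, y, rfl⟩ := hex₂ a b
    rw [← map_add, hΦ hg, hΦ hg, hΦ hg, map_add, map_add, map_add]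
  have hsmul : ∀ (c : k) a, Φ (c • a) = c • Φ a := by
    intro c a
    obtain ⟨X, g, hg, ⟨x, rfl⟩, -⟩ := hex₂ a a
    rw [← map_smul, hΦ hg, hΦ hg, map_smul, map_smul, map_smul]
  have hmul : ∀ a b, Φ (a * b) = Φ a * Φ b := by
    intro a b
    obtain ⟨X, g, hg, ⟨x, rfl⟩, y, rfl⟩ := hex₂ a b
    have h := hΦ (hg.mul hg) (x ⊗ₜ[k] y)
    rw [htensor] at h
    rw [hΦ hg, hΦ hg, ← Bialgebra.counit_mul]
    exact h
  have hone : Φ 1 = 1 := by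
    have h : (unit k A).IsColinear (Algebra.linearMap k A) := by
      refine LinearMap.ext_ring ?_
      change comul (R := k) (algebraMap k A 1) =
        (Algebra.linearMap k A).rTensor A ((1 : k) ⊗ₜ[k] (1 : A))
      simp [Algebra.TensorProduct.one_def]
    have h' := hΦ h (1 : k)
    rw [hunit] at h'
    change Φ (algebraMap k A 1) = counit (R := k) (algebraMap k A 1) at h'
    simpa using h'
  let Ψ : A →ₗ[k] k := ⟨⟨Φ, hadd⟩, hsmul⟩
  refine ⟨AlgHom.ofLinearMap Ψ hone hmul, fun X => LinearMap.ext fun x => ?_⟩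
  rw [← sub_eq_zero]
  refine (Module.forall_dual_apply_eq_zero_iff k _).1 fun f => ?_
  -- Matrix coefficients are colinear, so `Φ` of the coefficient `f(x₀) x₁` is `ε` of the
  -- coefficient at `θ x`, which is `f (θ x)`.
  rw [map_sub, sub_eq_zero, apply_formAction, ← counit_coefficient]
  exact (hΦ (X.isColinear_coefficient f) x).symm

/-- `A` is spanned by the entries of matrices of comodules. -/
lemma linearMap_ext_coactionMatrix {B : Type*} [AddCommGroup B] [Module k B] {f g : A →ₗ[k] B}
    (h : ∀ X : FinComod k A,
      (coactionMatrix (Module.finBasis k X.carrier) X.coact).map f =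
        (coactionMatrix (Module.finBasis k X.carrier) X.coact).map g) : f = g := by
  ext a
  obtain ⟨V, _, hV, ha⟩ := exists_subcomodule (k := k) a
  obtain ⟨X, j, -, hjr, hj⟩ := hV.exists_embedding
  rw [← hjr] at ha
  obtain ⟨x, rfl⟩ := ha
  suffices f ∘ₗ j = g ∘ₗ j from LinearMap.congr_fun this x
  refine (Module.finBasis k X.carrier).ext fun l => ?_
  -- Applying `ε` to the first leg of the colinearity equation writes elements of the image of `j`
  -- as combinations of matrix entries.
  have h₁ : j (Module.finBasis k X.carrier l) = ∑ i,
      counit (R := k) (j (Module.finBasis k X.carrier i)) •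
        coactionMatrix (Module.finBasis k X.carrier) X.coact i l := by
    have h₂ := congrArg (fun t => TensorProduct.lid k A ((counit (R := k)).rTensor A t))
      (LinearMap.congr_fun hj (Module.finBasis k X.carrier l))
    simpa [coaction_basis] using h₂
  have h₃ : ∀ i, f (coactionMatrix (Module.finBasis k X.carrier) X.coact i l) =
      g (coactionMatrix (Module.finBasis k X.carrier) X.coact i l) :=
    fun i => congrFun (congrFun (h X) i) l
  rw [LinearMap.comp_apply, LinearMap.comp_apply, h₁]
  simp only [map_sum, map_smul, h₃]

end FinComod

/-! ### Bilinear forms of pairings of comodules -/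

namespace FinComod

variable {k : Type u} [Field k] {A : Type w} [Ring A] [Bialgebra k A]

/-- The bilinear form of a pairing of comodules. -/
def form {X Y : FinComod k A} (e : X ⊗ Y ⟶ 𝟙_ (FinComod k A)) :
    X.carrier →ₗ[k] Y.carrier →ₗ[k] k :=
  TensorProduct.curry (linMap e : X.carrier ⊗[k] Y.carrier →ₗ[k] k)

lemma linMap_comp {X Y Z : FinComod k A} (f : X ⟶ Y) (g : Y ⟶ Z) (x : X.carrier) :
    linMap (f ≫ g) x = linMap g (linMap f x) := rfl

lemma form_whiskerRight {X X' Y : FinComod k A} (f : X ⟶ X') (e : X' ⊗ Y ⟶ 𝟙_ (FinComod k A))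
    (x : X.carrier) (y : Y.carrier) : form (f ▷ Y ≫ e) x y = form e (linMap f x) y := rfl

lemma form_whiskerLeft {X Y Y' : FinComod k A} (f : Y ⟶ Y') (e : X ⊗ Y' ⟶ 𝟙_ (FinComod k A))
    (x : X.carrier) (y : Y.carrier) : form (X ◁ f ≫ e) x y = form e x (linMap f y) := rfl

lemma form_rightUnitor_comm (x y : (𝟙_ (FinComod k A) : FinComod k A).carrier) :
    form (ρ_ (𝟙_ (FinComod k A))).hom x y = form (ρ_ (𝟙_ (FinComod k A))).hom y x :=
  mul_comm (G := k) y x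

lemma form_mapExactPairing {X Y : FinComod k A} (p : ExactPairing X Y) :
    FGModuleCat.form (mapExactPairing (forgetful k A) p).evaluation = form p.evaluation := rfl

lemma isPerfPair_form {X Y : FinComod k A} (p : ExactPairing X Y) :
    (form p.evaluation).IsPerfPair :=
  LinearMap.IsPerfPair.of_injective
    (form_mapExactPairing p ▸ FGModuleCat.form_evaluation_injective _)
    (form_mapExactPairing p ▸ FGModuleCat.form_evaluation_flip_injective _)

section Autonomous

variable (𝒜 : AutonomousStructure (FinComod k A))

instance (X : FinComod k A) : (form (𝒜.leftEval X)).IsPerfPair := isPerfPair_form _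

instance (X : FinComod k A) : (form (𝒜.rightEval X)).IsPerfPair := isPerfPair_form _

lemma hom_ext_leftEval {X Z : FinComod k A} {f g : Z ⟶ 𝒜.leftObj X}
    (h : ∀ z x, form (𝒜.leftEval X) (linMap f z) x = form (𝒜.leftEval X) (linMap g z) x) :
    f = g := by
  refine hom_ext (LinearMap.ext fun z => ?_)
  exact (LinearMap.IsPerfPair.bijective_left (p := form (𝒜.leftEval X))).1
    (LinearMap.ext (h z))

/-- The form of a nested pairing is the product of the forms. -/
lemma form_nested {X₁ X₂ Y₁ Y₂ : FinComod k A} (e₁ : Y₁ ⊗ X₁ ⟶ 𝟙_ (FinComod k A))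
    (e₂ : Y₂ ⊗ X₂ ⟶ 𝟙_ (FinComod k A)) (x₁ : X₁.carrier) (x₂ : X₂.carrier)
    (y₁ : Y₁.carrier) (y₂ : Y₂.carrier) :
    form ((α_ Y₂ Y₁ (X₁ ⊗ X₂)).hom ≫ Y₂ ◁ ((α_ Y₁ X₁ X₂).inv ≫ e₁ ▷ X₂ ≫ (λ_ X₂).hom) ≫ e₂)
      (y₂ ⊗ₜ[k] y₁ : Y₂.carrier ⊗[k] Y₁.carrier) (x₁ ⊗ₜ[k] x₂ : X₁.carrier ⊗[k] X₂.carrier) =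
      form e₁ y₁ x₁ * form e₂ y₂ x₂ := by
  change form e₂ y₂ (form e₁ y₁ x₁ • x₂) = _
  rw [map_smul, smul_eq_mul]

/-- `f : Xᵛ ⟶ ᵛX` corresponds to the linear endomorphism `θ` of `X`. -/
def Corresponds {X : FinComod k A} (f : 𝒜.rightObj X ⟶ 𝒜.leftObj X)
    (θ : X.carrier →ₗ[k] X.carrier) : Prop :=
  ∀ ξ x, form (𝒜.leftEval X) (linMap f ξ) x = form (𝒜.rightEval X) (θ x) ξ

/-- The constraints turn the evaluations of `X ⊗ Y` into nested evaluations, whose forms are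
products. The order is `g ⊗ₘ f` because duality reverses tensor factors. -/
lemma corresponds_tensor {X Y : FinComod k A} {f : 𝒜.rightObj X ⟶ 𝒜.leftObj X}
    {g : 𝒜.rightObj Y ⟶ 𝒜.leftObj Y} {θ : X.carrier →ₗ[k] X.carrier}
    {θ' : Y.carrier →ₗ[k] Y.carrier} (hf : Corresponds 𝒜 f θ) (hg : Corresponds 𝒜 g θ') :
    Corresponds 𝒜 ((𝒜.rightTensorIso X Y).hom ≫ (g ⊗ₘ f) ≫ (𝒜.leftTensorIso X Y).inv)
      (X := X ⊗ Y) (TensorProduct.map θ θ') := by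
  have key : ∀ (ζ : (𝒜.rightObj Y).carrier ⊗[k] (𝒜.rightObj X).carrier)
      (z : X.carrier ⊗[k] Y.carrier),
      form ((α_ _ _ _).hom ≫ 𝒜.leftObj Y ◁ ((α_ _ _ _).inv ≫ 𝒜.leftEval X ▷ Y ≫ (λ_ Y).hom) ≫
        𝒜.leftEval Y) (TensorProduct.map (linMap g) (linMap f) ζ) z =
      form ((α_ _ _ _).hom ≫ X ◁ ((α_ _ _ _).inv ≫ 𝒜.rightEval Y ▷ _ ≫ (λ_ _).hom) ≫
        𝒜.rightEval X) (TensorProduct.map θ θ' z) ζ := by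
    intro ζ z
    induction ζ with
    | zero => rw [map_zero]; exact (LinearMap.map_zero₂ _ _).trans (map_zero _).symm
    | add s t hs ht =>
      rw [map_add]
      exact (LinearMap.map_add₂ _ _ _ _).trans ((congrArg₂ _ hs ht).trans (map_add _ _ _).symm)
    | tmul η ξ =>
      induction z with
      | zero => rw [map_zero]; exact (map_zero _).trans (LinearMap.map_zero₂ _ _).symm
      | add s t hs ht =>
        rw [map_add]
        exact (map_add _ _ _).trans ((congrArg₂ _ hs ht).trans (LinearMap.map_add₂ _ _ _ _).symm)
      | tmul x y =>
        rw [TensorProduct.map_tmul, TensorProduct.map_tmul]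
        refine (form_nested _ _ _ _ _ _).trans (Eq.trans ?_ (form_nested _ _ _ _ _ _).symm)
        rw [hf, hg, mul_comm]
  intro ζ z
  rw [← 𝒜.leftTensorIso_comp_eval, ← 𝒜.rightTensorIso_comp_eval, form_whiskerRight,
    form_whiskerLeft, ← linMap_comp, Category.assoc, Category.assoc, Iso.inv_hom_id,
    Category.comp_id, linMap_comp]
  exact key _ z

lemma corresponds_unit :
    Corresponds 𝒜 (𝒜.rightUnitIso.hom ≫ 𝒜.leftUnitIso.inv) LinearMap.id := by
  intro ξ x
  rw [← 𝒜.leftUnitIso_comp_eval, ← 𝒜.rightUnitIso_comp_eval, form_whiskerRight,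
    form_whiskerLeft, ← linMap_comp, Category.assoc, Iso.inv_hom_id, Category.comp_id,
    form_rightUnitor_comm]
  rfl

variable {𝒜}

lemma Corresponds.endomorphism_unique {X : FinComod k A} {f : 𝒜.rightObj X ⟶ 𝒜.leftObj X}
    {θ θ' : X.carrier →ₗ[k] X.carrier} (h : Corresponds 𝒜 f θ) (h' : Corresponds 𝒜 f θ') :
    θ = θ' :=
  LinearMap.ext fun x => (LinearMap.IsPerfPair.bijective_left (p := form (𝒜.rightEval X))).1
    (LinearMap.ext fun ξ => (h ξ x).symm.trans (h' ξ x))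

lemma Corresponds.hom_unique {X : FinComod k A} {f f' : 𝒜.rightObj X ⟶ 𝒜.leftObj X}
    {θ : X.carrier →ₗ[k] X.carrier} (h : Corresponds 𝒜 f θ) (h' : Corresponds 𝒜 f' θ) : f = f' :=
  hom_ext_leftEval 𝒜 fun ξ x => (h ξ x).trans (h' ξ x).symm

variable (𝒜) in
-- For fixed `x`, the functional `ξ ↦ ⟨f ξ, x⟩` is represented by a unique vector, as the right
-- evaluation is perfect.
lemma exists_corresponds {X : FinComod k A} (f : 𝒜.rightObj X ⟶ 𝒜.leftObj X) :
    ∃ θ : X.carrier →ₗ[k] X.carrier, Corresponds 𝒜 f θ := by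
  refine ⟨(form (𝒜.rightEval X)).toPerfPair.symm.toLinearMap ∘ₗ
    (form (𝒜.leftEval X) ∘ₗ linMap f).flip, fun ξ x => ?_⟩
  simp

/-- Naturality of `f` corresponds to naturality of `θ`. -/
lemma Corresponds.naturality_iff {X Y : FinComod k A} {f : 𝒜.rightObj X ⟶ 𝒜.leftObj X}
    {g : 𝒜.rightObj Y ⟶ 𝒜.leftObj Y} {θ : X.carrier →ₗ[k] X.carrier}
    {θ' : Y.carrier →ₗ[k] Y.carrier} (hf : Corresponds 𝒜 f θ) (hg : Corresponds 𝒜 g θ')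
    (a : X ⟶ Y) :
    𝒜.rightMap a ≫ f = g ≫ 𝒜.leftMap a ↔ ∀ x, θ' (linMap a x) = linMap a (θ x) := by
  have h₁ : ∀ ξ x, form (𝒜.leftEval X) (linMap (𝒜.rightMap a ≫ f) ξ) x =
      form (𝒜.rightEval Y) (linMap a (θ x)) ξ := by
    intro ξ x
    rw [linMap_comp, hf, ← form_whiskerLeft, 𝒜.rightMap_comp_rightEval, form_whiskerRight]
  have h₂ : ∀ ξ x, form (𝒜.leftEval X) (linMap (g ≫ 𝒜.leftMap a) ξ) x =
      form (𝒜.rightEval Y) (θ' (linMap a x)) ξ := by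
    intro ξ x
    rw [linMap_comp, ← form_whiskerRight (𝒜.leftMap a), 𝒜.leftMap_comp_leftEval, form_whiskerLeft,
      hg]
  constructor
  · intro h x
    refine (LinearMap.IsPerfPair.bijective_left (p := form (𝒜.rightEval Y))).1
      (LinearMap.ext fun ξ => ?_)
    rw [← h₁, ← h₂, h]
  · intro h
    refine hom_ext_leftEval 𝒜 fun ξ x => ?_
    rw [h₁, h₂, h]

/-- A vector in the kernel of `f` pairs to zero with the image of `θ`, which is all of `X`; both
duals have the dimension of `X`. -/
lemma Corresponds.bijective {X : FinComod k A} {f : 𝒜.rightObj X ⟶ 𝒜.leftObj X}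
    {θ : X.carrier →ₗ[k] X.carrier} (hf : Corresponds 𝒜 f θ) (hθ : Function.Surjective θ) :
    Function.Bijective (linMap f) := by
  have hi : Function.Injective (linMap f) := by
    refine (injective_iff_map_eq_zero _).2 fun ξ hξ => ?_
    refine (LinearMap.IsPerfPair.bijective_right (p := form (𝒜.rightEval X))).1
      (LinearMap.ext fun y => ?_)
    obtain ⟨x, rfl⟩ := hθ y
    rw [LinearMap.flip_apply, ← hf, hξ]
    simp
  have hd : Module.finrank k (𝒜.rightObj X).carrier = Module.finrank k (𝒜.leftObj X).carrier :=
    (Module.finrank_of_isPerfPair (form (𝒜.rightEval X))).symm.trans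
      (Module.finrank_of_isPerfPair (form (𝒜.leftEval X))).symm
  exact ⟨hi, (LinearMap.injective_iff_surjective_of_finrank_eq_finrank hd).1 hi⟩

end Autonomous

/-- The forgetful functor is sovereign, for any sovereign structure on vector spaces, if and only
if the sovereign structure on comodules corresponds to the identity. -/
lemma isSovereignFunctor_forgetful_iff (𝒮 : SovereignStructure (FinComod k A))
    (ψ : SovereignStructure (FGModuleCat.{u} k)) :
    IsSovereignFunctor (forgetful k A) 𝒮 ψ ↔
      ∀ X, Corresponds 𝒮.toAutonomousStructure (𝒮.component X) LinearMap.id := by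
  refine forall_congr' fun X => ?_
  let V := (forgetful k A).obj X
  let r := rightComparison (forgetful k A) 𝒮.toAutonomousStructure ψ.toAutonomousStructure X
  let l := leftComparison (forgetful k A) 𝒮.toAutonomousStructure ψ.toAutonomousStructure X
  have hr : ∀ x ξ, form (𝒮.rightEval X) x (FGModuleCat.lin r.hom ξ) =
      FGModuleCat.form (ψ.rightEval V) x ξ := fun x ξ =>
    congrArg (fun t => FGModuleCat.form t x ξ) (leftDualIso_hom_comp_evaluation
      (ψ.rightPairing V) (mapExactPairing (forgetful k A) (𝒮.rightPairing X)))
  have hl : ∀ ξ x, form (𝒮.leftEval X) (FGModuleCat.lin l.hom ξ) x =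
      FGModuleCat.form (ψ.leftEval V) ξ x := fun ξ x =>
    congrArg (fun t => FGModuleCat.form t ξ x) (rightDualIso_hom_comp_evaluation
      (ψ.leftPairing V) (mapExactPairing (forgetful k A) (𝒮.leftPairing X)))
  have hs : Function.Surjective (FGModuleCat.lin r.hom) := fun y =>
    ⟨FGModuleCat.lin r.inv y, congrArg (fun t => FGModuleCat.lin t y) r.inv_hom_id⟩
  -- Since `ψ` is canonical, `l ∘ ψ` and `r` intertwine the two evaluations of comodules, whatever
  -- `ψ` is.
  have hψ : ∀ ξ x, form (𝒮.leftEval X) (FGModuleCat.lin l.hom (FGModuleCat.lin (ψ.component V) ξ)) x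
      = form (𝒮.rightEval X) x (FGModuleCat.lin r.hom ξ) := fun ξ x =>
    (hl _ x).trans ((FGModuleCat.form_leftEval_component ψ V ξ x).trans (hr x ξ).symm)
  have hc : ∀ ξ, FGModuleCat.lin (r.hom ≫ (forgetful k A).map (𝒮.component X)) ξ =
      linMap (𝒮.component X) (FGModuleCat.lin r.hom ξ) := fun _ => rfl
  change r.hom ≫ (forgetful k A).map (𝒮.component X) = ψ.component V ≫ l.hom ↔ _
  constructor
  · intro h η x
    obtain ⟨ξ, rfl⟩ := hs η
    rw [← hc, h, FGModuleCat.lin_comp, hψ, LinearMap.id_apply]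
  · intro h
    refine FGModuleCat.hom_ext (LinearMap.ext fun ξ => ?_)
    refine (LinearMap.IsPerfPair.bijective_left (p := form (𝒮.leftEval X))).1
      (LinearMap.ext fun x => ?_)
    exact (h (FGModuleCat.lin r.hom ξ) x).trans (hψ ξ x).symm

/-! ### The action of a character -/

lemma formAction_naturality (Φ : A →ₗ[k] k) {X Y : FinComod k A} (a : X ⟶ Y) (x : X.carrier) :
    formAction Φ Y (linMap a x) = linMap a (formAction Φ X x) := by
  have h := LinearMap.congr_fun (linMap_comm a) x
  simp only [formAction, LinearMap.comp_apply, LinearEquiv.coe_coe] at h ⊢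
  rw [h]
  generalize X.coact x = t
  induction t with
  | zero => simp
  | add s t hs ht => simp only [map_add, hs, ht]
  | tmul v a => simp

lemma formAction_tensor (Φ : A →ₐ[k] k) (X Y : FinComod k A) :
    formAction Φ.toLinearMap (X.tensor Y) =
      TensorProduct.map (formAction Φ.toLinearMap X) (formAction Φ.toLinearMap Y) := by
  refine TensorProduct.ext' fun x y => ?_
  have key : ∀ (s : X.carrier ⊗[k] A) (t : Y.carrier ⊗[k] A),
      TensorProduct.rid k _ (Φ.toLinearMap.lTensor _ ((LinearMap.mul' k A).lTensor _
        (TensorProduct.tensorTensorTensorComm k _ A _ A (s ⊗ₜ[k] t)))) =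
      TensorProduct.rid k _ (Φ.toLinearMap.lTensor _ s) ⊗ₜ[k]
        TensorProduct.rid k _ (Φ.toLinearMap.lTensor _ t) := by
    intro s t
    induction s with
    | zero => simp
    | add s₁ s₂ h₁ h₂ => simp only [TensorProduct.add_tmul, map_add, h₁, h₂]
    | tmul v a =>
      induction t with
      | zero => simp
      | add t₁ t₂ h₁ h₂ => simp only [TensorProduct.tmul_add, map_add, h₁, h₂]
      | tmul w b => simp [TensorProduct.smul_tmul', smul_smul, mul_comm]
  exact key _ _

lemma formAction_unit (Φ : A →ₐ[k] k) : formAction Φ.toLinearMap (unit k A) = LinearMap.id := by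
  refine LinearMap.ext_ring ?_
  change TensorProduct.rid k k (Φ.toLinearMap.lTensor k ((1 : k) ⊗ₜ[k] (1 : A))) = (1 : k)
  simp

lemma formAction_counit (X : FinComod k A) :
    formAction (Bialgebra.counitAlgHom k A).toLinearMap X = LinearMap.id :=
  X.isCoaction.counit

lemma formAction_basis {n : Type*} [Fintype n] (Φ : A →ₗ[k] k) (X : FinComod k A)
    (b : Module.Basis n k X.carrier) (j : n) :
    formAction Φ X (b j) = ∑ i, Φ (coactionMatrix b X.coact i j) • b i := by
  simp [formAction, coaction_basis]

/-- A sovereign structure on comodules corresponds to the action of a character. -/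
theorem _root_.SovereignStructure.exists_character (𝒮 : SovereignStructure (FinComod k A)) :
    ∃ Φ : A →ₐ[k] k, ∀ X, Corresponds 𝒮.toAutonomousStructure (𝒮.component X)
      (formAction Φ.toLinearMap X) := by
  choose θ hθ using fun X => exists_corresponds 𝒮.toAutonomousStructure (𝒮.component X)
  -- Naturality and the two constraints of the sovereign structure become the three hypotheses of
  -- the reconstruction, through uniqueness of `θ`.
  obtain ⟨Φ, hΦ⟩ := FinComod.exists_character θ
    (fun f => ((hθ _).naturality_iff (hθ _) f).1 (𝒮.component_naturality f))
    (fun X Y => by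
      refine (hθ (X ⊗ Y)).endomorphism_unique ?_
      have h := corresponds_tensor 𝒮.toAutonomousStructure (hθ X) (hθ Y)
      rwa [← Category.assoc, ← 𝒮.component_tensor, Category.assoc, Iso.hom_inv_id,
        Category.comp_id] at h)
    (by
      refine (hθ (𝟙_ _)).endomorphism_unique ?_
      have h := corresponds_unit 𝒮.toAutonomousStructure
      rwa [← 𝒮.component_unit, Category.assoc, Iso.hom_inv_id, Category.comp_id] at h)
  exact ⟨Φ, fun X => hΦ X ▸ hθ X⟩

/-- A family of morphisms that corresponds to the action of a character is a sovereign
structure. -/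
theorem exists_sovereignStructure (𝒜 : AutonomousStructure (FinComod k A)) (Φ : A →ₐ[k] k)
    (hΦ : ∀ X, Function.Surjective (formAction Φ.toLinearMap X))
    (f : ∀ X, 𝒜.rightObj X ⟶ 𝒜.leftObj X)
    (hf : ∀ X, Corresponds 𝒜 (f X) (formAction Φ.toLinearMap X)) :
    ∃ 𝒮 : SovereignStructure (FinComod k A), ∀ X,
      Corresponds 𝒮.toAutonomousStructure (𝒮.component X) (formAction Φ.toLinearMap X) := by
  let i : ∀ X, 𝒜.rightObj X ≅ 𝒜.leftObj X := fun X =>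
    isoMk (LinearEquiv.ofBijective (linMap (f X)) ((hf X).bijective (hΦ X))) (linMap_comm (f X))
  refine ⟨{ 𝒜 with
    φ := NatIso.ofComponents (fun X => i X.unop) fun {X Y} a =>
      ((hf _).naturality_iff (hf _) a.unop).2 fun x => formAction_naturality _ _ _
    φ_tensor := fun X Y => ?_
    φ_unit := ?_ }, hf⟩
  · change f (X ⊗ Y) ≫ _ = _ ≫ (f Y ⊗ₘ f X)
    rw [← Iso.eq_comp_inv, Category.assoc]
    refine (hf (X ⊗ Y)).hom_unique ?_
    have h := corresponds_tensor 𝒜 (hf X) (hf Y)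
    rw [← formAction_tensor] at h
    exact h
  · change f (𝟙_ _) ≫ _ = _
    rw [← Iso.eq_comp_inv]
    refine (hf (𝟙_ _)).hom_unique ?_
    have h := corresponds_unit 𝒜
    rw [← formAction_unit Φ] at h
    exact h

end FinComod

/-! ### Sovereign characters and sovereign structures -/

namespace FinComod

open HopfAlgebra WithConv
open scoped Matrix

variable {k : Type u} [Field k] {A : Type w} [Ring A] [HopfAlgebra k A]

/-- The map `Φ * S * Φ⁻¹`. -/
def conjAntipode (Φ : A →ₐ[k] k) : A →ₗ[k] A :=
  (convForm Φ.toLinearMap * toConv (antipode k (A := A)) * convForm (charInv Φ)).ofConv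

/-- The right-hand side does not mention `S⁻¹`, so it also makes sense in the second part, where `S`
is not assumed bijective. -/
lemma isSovereignCharacter_iff (hS : Function.Bijective (antipode k (A := A))) (Φ : A →ₐ[k] k) :
    IsSovereignCharacter hS Φ ↔ antipode k ∘ₗ conjAntipode Φ = LinearMap.id := by
  set e := LinearEquiv.ofBijective (antipode k (A := A)) hS with he
  have h₁ : IsSovereignCharacter hS Φ ↔ e.symm.toLinearMap = conjAntipode Φ :=
    ⟨fun h => congrArg WithConv.ofConv h, fun h => congrArg WithConv.toConv h⟩
  rw [h₁]
  constructor
  · intro h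
    rw [← h]
    exact LinearMap.ext fun a => e.apply_symm_apply a
  · intro h
    refine LinearMap.ext fun a => e.injective ?_
    exact (e.apply_symm_apply a).trans (LinearMap.congr_fun h a).symm

lemma conjAntipode_counit :
    conjAntipode (Bialgebra.counitAlgHom k A) = antipode k (A := A) := by
  have h₁ : convForm (Bialgebra.counitAlgHom k A).toLinearMap = (1 : WithConv (A →ₗ[k] A)) := rfl
  have h₂ : convForm (charInv (Bialgebra.counitAlgHom k A)) = (1 : WithConv (A →ₗ[k] A)) := by
    rw [← h₁]
    congr 1
    exact HopfAlgebra.counit_comp_antipode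
  rw [conjAntipode, h₁, h₂, one_mul, mul_one, ofConv_toConv]

variable {n : Type*} [Fintype n]

/-- The image of a matrix over `A` under a character, again as a matrix over `A`. -/
def charMatrix (Φ : A →ₐ[k] k) (M : Matrix n n A) : Matrix n n A :=
  M.map ((Algebra.ofId k A).comp Φ)

lemma charMatrix_mul_eq_one [DecidableEq n] (Φ : A →ₐ[k] k) {M N : Matrix n n A} (h : M * N = 1) :
    charMatrix Φ M * charMatrix Φ N = 1 := by
  rw [charMatrix, charMatrix, ← Matrix.map_mul, h, Matrix.map_one _ (map_zero _) (map_one _)]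

lemma map_conjAntipode [DecidableEq n] (Φ : A →ₐ[k] k) {M : Matrix n n A} (hM : IsComatrix k M) :
    M.map (conjAntipode Φ) =
      charMatrix Φ M * M.map (antipode k) * charMatrix Φ (M.map (antipode k)) := by
  rw [conjAntipode, hM.convMul_apply, hM.convMul_apply]
  rfl

/-- The action of `Φ ∘ S` is a right inverse, because `Φ(M) Φ(S M) = Φ(M S(M)) = 1`. -/
lemma surjective_formAction (Φ : A →ₐ[k] k) (X : FinComod k A) :
    Function.Surjective (formAction Φ.toLinearMap X) := by
  let b := Module.finBasis k X.carrier
  have hM := X.isComatrix_coactionMatrix b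
  set M := coactionMatrix b X.coact with hMdef
  have h₁ : (M.map Φ) * ((M.map (antipode k)).map Φ) = 1 := by
    rw [← Matrix.map_mul, hM.mul_map_antipode, Matrix.map_one _ (map_zero _) (map_one _)]
  have h₂ : formAction Φ.toLinearMap X ∘ₗ formAction (charInv Φ) X = LinearMap.id := by
    refine b.ext fun j => ?_
    rw [LinearMap.comp_apply, formAction_basis, map_sum]
    simp only [map_smul, formAction_basis, Finset.smul_sum, smul_smul]
    rw [Finset.sum_comm]
    simp only [← Finset.sum_smul]
    have h₃ : ∀ l, ∑ i, charInv Φ (M i j) * Φ.toLinearMap (M l i) = (1 : Matrix _ _ k) l j := by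
      intro l
      rw [← h₁, Matrix.mul_apply]
      exact Finset.sum_congr rfl fun i _ => mul_comm _ _
    simp only [← hMdef, h₃, Matrix.one_apply]
    simp
  exact fun x => ⟨_, LinearMap.congr_fun h₂ x⟩

/-- The Gram matrix of a pairing of comodules is invariant. -/
lemma transpose_mul_gram_mul {X Y : FinComod k A} (e : X ⊗ Y ⟶ 𝟙_ (FinComod k A))
    (b : Module.Basis n k X.carrier) (c : Module.Basis n k Y.carrier) {E : Matrix n n A}
    (hE : ∀ i j, E i j = algebraMap k A (form e (b i) (c j))) :
    (coactionMatrix b X.coact)ᵀ * E * coactionMatrix c Y.coact = E := by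
  obtain rfl : E = Matrix.of fun i j => algebraMap k A (form e (b i) (c j)) := by
    ext i j
    exact hE i j
  exact (form_colinear_iff b c X.coact Y.coact (linMap e)).1 (linMap_comm e)

variable (𝒜 : AutonomousStructure (FinComod k A))

/-- In the basis dual to `b`, the matrix `N` of the right dual satisfies `S(Nᵀ) = M`. -/
lemma exists_dual_basis [DecidableEq n] (X : FinComod k A) (b : Module.Basis n k X.carrier) :
    ∃ c : Module.Basis n k (𝒜.rightObj X).carrier,
      (∀ i j, form (𝒜.rightEval X) (b i) (c j) = (1 : Matrix n n k) i j) ∧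
      (coactionMatrix c (𝒜.rightObj X).coact)ᵀ.map (antipode k) = coactionMatrix b X.coact := by
  let c := b.dualBasis.map (form (𝒜.rightEval X)).flip.toPerfPair.symm
  have hc : ∀ i j, form (𝒜.rightEval X) (b i) (c j) = (1 : Matrix n n k) i j := by
    intro i j
    rw [Module.Basis.map_apply, LinearMap.apply_toPerfPair_flip, Module.Basis.dualBasis_apply_self,
      Matrix.one_apply]
  refine ⟨c, hc, ?_⟩
  have hM := X.isComatrix_coactionMatrix b
  have h₁ := transpose_mul_gram_mul (𝒜.rightEval X) b c (E := 1) fun i j => by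
    rw [hc, Matrix.one_apply, Matrix.one_apply]
    split_ifs <;> simp
  rw [Matrix.mul_one] at h₁
  -- Applying `S` to `Mᵀ N = 1` gives `S(Nᵀ) S(M) = 1`, while `S(M) M = 1`. Bijectivity of `S` plays
  -- no role.
  refine left_inv_eq_right_inv (a := (coactionMatrix b X.coact).map (antipode k)) ?_
    hM.map_antipode_mul
  ext i j
  have h₃ := congrArg (antipode k) (congrFun (congrFun h₁ j) i)
  rw [Matrix.mul_apply, map_sum] at h₃
  simp only [antipode_mul_antidistrib, Matrix.transpose_apply] at h₃
  rw [Matrix.mul_apply]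
  simp only [Matrix.map_apply, Matrix.transpose_apply]
  rw [h₃, Matrix.one_apply, Matrix.one_apply]
  simp only [eq_comm (a := j)]
  split_ifs <;> simp

variable {𝒜}

/-- If the action of a character corresponds to comodule morphisms `Xᵛ ⟶ ᵛX`, then
`S ∘ (Φ * S * Φ⁻¹) = id`. -/
theorem antipode_comp_conjAntipode {Φ : A →ₐ[k] k} {f : ∀ X, 𝒜.rightObj X ⟶ 𝒜.leftObj X}
    (hf : ∀ X, Corresponds 𝒜 (f X) (formAction Φ.toLinearMap X)) :
    antipode k ∘ₗ conjAntipode Φ = LinearMap.id := by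
  refine linearMap_ext_coactionMatrix fun X => ?_
  let b := Module.finBasis k X.carrier
  have hM := X.isComatrix_coactionMatrix b
  obtain ⟨c, hc, hN⟩ := exists_dual_basis 𝒜 X b
  -- The pairing `⟨f ξ, x⟩` has Gram matrix `Φ(M)`, so its invariance reads `Nᵀ Φ(M) M = Φ(M)`; the
  -- calculation below solves this for `Nᵀ`.
  have h₁ := transpose_mul_gram_mul (f X ▷ X ≫ 𝒜.leftEval X) c b
    (E := charMatrix Φ (coactionMatrix b X.coact)) fun i j => by
      rw [form_whiskerRight, hf X, formAction_basis]
      simp [hc, Matrix.one_apply, charMatrix, Algebra.ofId_apply]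
  change (coactionMatrix b X.coact).map _ = (coactionMatrix b X.coact).map _
  set M := coactionMatrix b X.coact
  set N := coactionMatrix c (𝒜.rightObj X).coact
  have h₃ : Nᵀ = M.map (conjAntipode Φ) := by
    rw [map_conjAntipode Φ hM]
    calc Nᵀ = Nᵀ * (charMatrix Φ M * (M * M.map (antipode k)) *
          charMatrix Φ (M.map (antipode k))) := by
          rw [hM.mul_map_antipode, Matrix.mul_one, charMatrix_mul_eq_one Φ hM.mul_map_antipode,
            Matrix.mul_one]
      _ = (Nᵀ * charMatrix Φ M * M) * M.map (antipode k) *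
          charMatrix Φ (M.map (antipode k)) := by
          simp only [Matrix.mul_assoc]
      _ = _ := by rw [h₁]
  rw [h₃] at hN
  ext i j
  exact congrFun (congrFun hN i) j

/-- If `S ∘ (Φ * S * Φ⁻¹) = id`, the action of `Φ` corresponds to a comodule morphism. -/
theorem exists_hom_corresponds (hS : Function.Injective (antipode k (A := A))) {Φ : A →ₐ[k] k}
    (hΦ : antipode k ∘ₗ conjAntipode Φ = LinearMap.id) (X : FinComod k A) :
    ∃ f : 𝒜.rightObj X ⟶ 𝒜.leftObj X, Corresponds 𝒜 f (formAction Φ.toLinearMap X) := by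
  let b := Module.finBasis k X.carrier
  have hM := X.isComatrix_coactionMatrix b
  obtain ⟨c, hc, hN⟩ := exists_dual_basis 𝒜 X b
  let t : (𝒜.rightObj X).carrier ⊗[k] X.carrier →ₗ[k] k :=
    TensorProduct.lift (form (𝒜.rightEval X) ∘ₗ formAction Φ.toLinearMap X).flip
  have ht : unitCoaction k A ∘ₗ t = t.rTensor A ∘ₗ
      tensorCoaction (𝒜.rightObj X).coact X.coact := by
    rw [form_colinear_iff c b]
    set M := coactionMatrix b X.coact with hMdef
    set N := coactionMatrix c (𝒜.rightObj X).coact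
    have h₂ : (Matrix.of fun i j => algebraMap k A (t (c i ⊗ₜ[k] b j))) = charMatrix Φ M := by
      ext i j
      rw [Matrix.of_apply]
      refine congrArg (algebraMap k A) ?_
      change form (𝒜.rightEval X) (formAction Φ.toLinearMap X (b j)) (c i) = _
      rw [formAction_basis]
      simp [hc, Matrix.one_apply, ← hMdef]
    -- Both sides are mapped to `M` by `S`, which is injective.
    have h₃ : Nᵀ = M.map (conjAntipode Φ) := by
      ext i j
      apply hS
      exact (congrFun (congrFun hN i) j).trans (LinearMap.congr_fun hΦ (M i j)).symm
    rw [h₂, h₃, map_conjAntipode Φ hM, Matrix.mul_assoc (charMatrix Φ M * M.map (antipode k)),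
      charMatrix_mul_eq_one Φ hM.map_antipode_mul, Matrix.mul_one, Matrix.mul_assoc,
      hM.map_antipode_mul, Matrix.mul_one]
  let τ : 𝒜.rightObj X ⊗ X ⟶ 𝟙_ (FinComod k A) := ⟨t, ht⟩
  -- The form `⟨θ x, ξ⟩` is now a morphism of comodules, so the universal property of the left dual
  -- makes `f` colinear automatically.
  obtain ⟨f, hf⟩ := exists_whiskerRight_comp_evaluation (𝒜.leftPairing X) τ
  exact ⟨f, fun ξ x => congrArg (fun s => form s ξ x) hf⟩

theorem exists_sovereignStructure_of_character (hS : Function.Bijective (antipode k (A := A)))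
    {Φ : A →ₐ[k] k} (hΦ : antipode k ∘ₗ conjAntipode Φ = LinearMap.id) :
    ∃ 𝒮 : SovereignStructure (FinComod k A), ∀ X,
      Corresponds 𝒮.toAutonomousStructure (𝒮.component X) (formAction Φ.toLinearMap X) := by
  obtain ⟨𝒜⟩ := (isAutonomous_of_bijective_antipode hS).nonempty_autonomousStructure
  choose f hf using exists_hom_corresponds (𝒜 := 𝒜) hS.1 hΦ
  exact exists_sovereignStructure 𝒜 Φ (surjective_formAction Φ) f hf

/-- Sovereignty forces `θ = id`, the action of the counit, and `ε * S * ε⁻¹ = S`. The duals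
contained in `𝒮` suffice here. -/
lemma antipode_comp_antipode_of_isSovereignFunctor {𝒮 : SovereignStructure (FinComod k A)}
    {ψ : SovereignStructure (FGModuleCat.{u} k)}
    (h : IsSovereignFunctor (forgetful k A) 𝒮 ψ) :
    antipode k (A := A) ∘ₗ antipode k (A := A) = LinearMap.id := by
  have h₁ := (isSovereignFunctor_forgetful_iff 𝒮 ψ).1 h
  have h₂ := antipode_comp_conjAntipode (Φ := Bialgebra.counitAlgHom k A) (f := 𝒮.component)
    fun X => by rw [formAction_counit]; exact h₁ X
  rwa [conjAntipode_counit] at h₂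

lemma exists_isSovereignFunctor
    (h : antipode k (A := A) ∘ₗ antipode k (A := A) = LinearMap.id) :
    IsAutonomous (FinComod k A) ∧ ∃ φ : SovereignStructure (FinComod k A),
      ∀ ψ : SovereignStructure (FGModuleCat.{u} k), IsSovereignFunctor (forgetful k A) φ ψ := by
  have hS : Function.Bijective (antipode k (A := A)) :=
    Function.bijective_iff_has_inverse.2 ⟨antipode k (A := A), LinearMap.congr_fun h,
      LinearMap.congr_fun h⟩
  obtain ⟨𝒮, h𝒮⟩ := exists_sovereignStructure_of_character hS
    (Φ := Bialgebra.counitAlgHom k A) (by rwa [conjAntipode_counit])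
  refine ⟨isAutonomous_of_bijective_antipode hS, 𝒮, fun ψ => ?_⟩
  rw [isSovereignFunctor_forgetful_iff]
  exact fun X => formAction_counit X ▸ h𝒮 X

end FinComod

end

/-! ### Assembly of the equivalences -/

theorem corollary3p15 {k : Type u} [Field k] {A : Type w} [Ring A] [HopfAlgebra k A] :
    (∀ hS : Function.Bijective (HopfAlgebra.antipode k (A := A)),
      (∃ Φ : A →ₐ[k] k, IsSovereignCharacter hS Φ) ↔
        Nonempty (SovereignStructure (FinComod k A))) ∧
    (HopfAlgebra.antipode k (A := A) ∘ₗ HopfAlgebra.antipode k (A := A) = LinearMap.id ↔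
      IsAutonomous (FinComod k A) ∧
        ∃ φ : SovereignStructure (FinComod k A), ∀ ψ : SovereignStructure (FGModuleCat.{u} k),
          IsSovereignFunctor (FinComod.forgetful k A) φ ψ) ∧
    (HopfAlgebra.antipode k (A := A) ∘ₗ HopfAlgebra.antipode k (A := A) = LinearMap.id ↔
      IsAutonomous (FinComod k A) ∧
        ∃ φ : SovereignStructure (FinComod k A), ∃ ψ : SovereignStructure (FGModuleCat.{u} k),
          IsSovereignFunctor (FinComod.forgetful k A) φ ψ) := by
  refine ⟨fun hS => ⟨?_, ?_⟩, ⟨FinComod.exists_isSovereignFunctor, ?_⟩, ⟨fun h => ?_, ?_⟩⟩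
  · rintro ⟨Φ, hΦ⟩
    obtain ⟨𝒮, -⟩ := FinComod.exists_sovereignStructure_of_character hS
      ((FinComod.isSovereignCharacter_iff hS Φ).1 hΦ)
    exact ⟨𝒮⟩
  · rintro ⟨𝒮⟩
    obtain ⟨Φ, hΦ⟩ := 𝒮.exists_character
    exact ⟨Φ, (FinComod.isSovereignCharacter_iff hS Φ).2 (FinComod.antipode_comp_conjAntipode hΦ)⟩
  · rintro ⟨-, φ, h⟩
    -- The hypothesis on all `ψ` has content only because some `ψ` exists.
    obtain ⟨ψ⟩ := FGModuleCat.nonempty_sovereignStructure (k := k)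
    exact FinComod.antipode_comp_antipode_of_isSovereignFunctor (h ψ)
  · obtain ⟨hA, φ, hφ⟩ := FinComod.exists_isSovereignFunctor h
    obtain ⟨ψ⟩ := FGModuleCat.nonempty_sovereignStructure (k := k)
    exact ⟨hA, φ, ψ, hφ ψ⟩
  · rintro ⟨-, φ, ψ, h⟩
    exact FinComod.antipode_comp_antipode_of_isSovereignFunctor h
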